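/- **Theorem 1.1.** Let $N\ge 1$, let $\Gamma_N=(\gamma_N^2(i,j))_{i,j=1,\dots,N}$ be a symmetric matrix with nonnegative entries ($\gamma_N(i,j)\ge 0$), and let $Y_N$ be a deterministic Hermitian $N\times N$ matrix. Let $X_N=\big(\gamma_N(i,j)\,x_{i,j}/\sqrt N\big)_{i,j}$ be a GUE matrix with variance profile $\Gamma_N$: the $x_{i,j}$ form a Hermitian random matrix, its entries on and below the diagonal are independent, the $x_{i,i}$ are real centered Gaussian variables of variance one, and for $i\ne j$ the $x_{i,j}$ are centered complex Gaussian variables of variance one (independent real and imaginary parts, each centered Gaussian of variance $1/2$). Put $H_N=X_N+Y_N$. Let $\mathrm D_N(\mathbb C)^+$ (resp. $\mathrm D_N(\mathbb C)^-$) be the set of complex diagonal $N\times N$ matrices whose diagonal entries have positive (resp. negative) imaginary part. Let $\Delta(A)$ be the diagonal matrix with the same diagonal as $A$, let $\|\cdot\|$ be the operator norm and $\Im m\,\Lambda=\frac1{2\mathbf i}(\Lambda-\Lambda^*)$, and let $$G_{H_N}(\Lambda)=\Delta\big[(\Lambda-H_N)^{-1}\big],\qquad \mathcal R_N(\Lambda)=\operatorname*{diag}_{i=1,\dots,N}\Big(\sum_{j=1}^N\frac{\gamma_N^2(i,j)}N\Lambda(j,j)\Big).$$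 There exists a unique function $G^\square_{H_N}:\mathrm D_N(\mathbb C)^+\to\mathrm D_N(\mathbb C)^-$, analytic in each variable (that is, its entries are analytic functions of each diagonal entry of $\Lambda$ separately), such that for every $\Lambda\in\mathrm D_N(\mathbb C)^+$ $$G^\square_{H_N}(\Lambda)=\Delta\Big[\big(\Lambda-\mathcal R_N(G^\square_{H_N}(\Lambda))-Y_N\big)^{-1}\Big].$$ Let $\gamma_{\max}=\big(\max_{i,j}\gamma_N^2(i,j)\big)^{1/2}$ and suppose moreover that $\gamma_{\max}>0$. Let $0<\delta<1$ and $d>1$. (a) If $\Lambda\in\mathrm D_N(\mathbb C)^+$ satisfies $\Im m\,\Lambda\ge\gamma_{\max}\big(\frac2{N(1-\delta)}\big)^{1/5}\,\mathbb I_N$, then $$\mathbb P\Big(\big\|G_{H_N}(\Lambda)-G^\square_{H_N}(\Lambda)\big\|\ge\varepsilon_N(d)\Big)\le 4N^{1-d}\qquad(1)$$ with $$\varepsilon_N(d)=\sqrt2\,\gamma_{\max}\sqrt{\frac{d\log N}N}\,\|(\Im m\,\Lambda)^{-1}\|^2+\Big(1+\frac{\gamma_{\max}^2}\delta\|(\Im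 m\,\Lambda)^{-1}\|^2\Big)\frac{2\gamma_{\max}^3\|(\Im m\,\Lambda)^{-1}\|^4}N .$$ (b) If $Y_N$ is diagonal and $\Lambda\in\mathrm D_N(\mathbb C)^+$ satisfies $\Im m\,\Lambda\ge\gamma_{\max}N^{-1/4}(1-\delta)^{-1/6}\,\mathbb I_N$, then (1) holds with $$\varepsilon_N(d)=\sqrt2\,\gamma_{\max}\sqrt{\frac{d\log N}N}\,\|(\Im m\,\Lambda)^{-1}\|^2+\Big(1+\frac{\gamma_{\max}^2}\delta\|(\Im m\,\Lambda)^{-1}\|^2\Big)\frac{\gamma_{\max}^4\|(\Im m\,\Lambda)^{-1}\|^5}{N^{3/2}} .$$ -/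

import Mathlib

-- The norm of a matrix is the operator norm subordinate to the Euclidean norm.
open scoped Matrix.Norms.L2Operator ComplexOrder ComplexStarModule ComplexConjugate
open MeasureTheory ProbabilityTheory

namespace DeformedGUE

/-- The set of diagonal matrices whose diagonal entries have positive imaginary part. -/
def diagPlus (N : ℕ) : Set (Matrix (Fin N) (Fin N) ℂ) :=
  {Λ | Λ.IsDiag ∧ ∀ i, 0 < (Λ i i).im}

/-- The set of diagonal matrices whose diagonal entries have negative imaginary part. -/
def diagMinus (N : ℕ) : Set (Matrix (Fin N) (Fin N) ℂ) :=
  {Λ | Λ.IsDiag ∧ ∀ i, (Λ i i).im < 0}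

/-- The map `Δ`: the diagonal matrix with the same diagonal entries as `A`. -/
def diagPart {N : ℕ} (A : Matrix (Fin N) (Fin N) ℂ) : Matrix (Fin N) (Fin N) ℂ :=
  Matrix.diagonal A.diag

/-- The operator-valued Stieltjes transform `G_A(Λ) = Δ[(Λ - A)⁻¹]`. -/
noncomputable def opStieltjes {N : ℕ} (A Λ : Matrix (Fin N) (Fin N) ℂ) :
    Matrix (Fin N) (Fin N) ℂ :=
  diagPart (Λ - A)⁻¹

/-- The map `R_N(Λ) = diag_i (∑_j (γ²(i,j) / N) Λ(j,j))`, where `Γ = (γ²(i,j))`. -/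
noncomputable def covMap {N : ℕ} (Γ : Matrix (Fin N) (Fin N) ℝ) (Λ : Matrix (Fin N) (Fin N) ℂ) :
    Matrix (Fin N) (Fin N) ℂ :=
  Matrix.diagonal fun i => ∑ j, ((Γ i j / N : ℝ) : ℂ) * Λ j j

/-- `γ_max`, the square root of `γ²_max = max_{i,j} γ²(i,j)`, where `Γ = (γ²(i,j))`. -/
noncomputable def gammaMax {N : ℕ} (Γ : Matrix (Fin N) (Fin N) ℝ) : ℝ :=
  √(⨆ p : Fin N × Fin N, Γ p.1 p.2)

/-- On the set of diagonal matrices `diag(v)` with `Im v_j > 0` for all `j`, the entries of `G` are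
analytic functions of each diagonal entry, the other ones being fixed. -/
def AnalyticInEachVariable {N : ℕ} (G : Matrix (Fin N) (Fin N) ℂ → Matrix (Fin N) (Fin N) ℂ) :
    Prop :=
  ∀ v : Fin N → ℂ, (∀ j, 0 < (v j).im) → ∀ i k l : Fin N,
    AnalyticOnNhd ℂ (fun z : ℂ => G (Matrix.diagonal (Function.update v i z)) k l)
      {z : ℂ | 0 < z.im}

/-- `G` maps `diagPlus N` to `diagMinus N`, is analytic in each variable, and solves the fixed
point equation `G(Λ) = Δ[(Λ - R_N(G(Λ)) - Y)⁻¹]` on `diagPlus N`. The values of `G` outside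
`diagPlus N` are irrelevant. -/
structure IsDeterministicEquivalent {N : ℕ} (Γ : Matrix (Fin N) (Fin N) ℝ)
    (Y : Matrix (Fin N) (Fin N) ℂ)
    (G : Matrix (Fin N) (Fin N) ℂ → Matrix (Fin N) (Fin N) ℂ) : Prop where
  mapsTo : Set.MapsTo G (diagPlus N) (diagMinus N)
  analytic : AnalyticInEachVariable G
  fixedPoint : ∀ Λ ∈ diagPlus N, G Λ = diagPart (Λ - covMap Γ (G Λ) - Y)⁻¹

/-- The law of a centered (circular) complex Gaussian variable of variance one: the real and
imaginary parts are independent centered real Gaussian variables of variance `1 / 2`. -/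
noncomputable def complexGaussian : Measure ℂ :=
  ((gaussianReal 0 (1 / 2)).prod (gaussianReal 0 (1 / 2))).map
    fun p : ℝ × ℝ => (⟨p.1, p.2⟩ : ℂ)

/-- `(x_{i,j} / √N)` is a GUE matrix: `x` is Hermitian, the entries on and below the diagonal are
independent, the diagonal entries are standard real Gaussian variables and the off-diagonal
ones are standard complex Gaussian variables. -/
structure IsStandardGUE {N : ℕ} {Ω : Type*} [MeasurableSpace Ω] (x : Fin N → Fin N → Ω → ℂ)
    (P : Measure Ω) : Prop where
  hermitian : ∀ i j ω, x j i ω = conj (x i j ω)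
  diag_law : ∀ i, HasLaw (fun ω => (x i i ω).re) (gaussianReal 0 1) P
  offDiag_law : ∀ i j, i ≠ j → HasLaw (x i j) complexGaussian P
  indep : iIndepFun (fun (p : {p : Fin N × Fin N // p.2 ≤ p.1}) => x p.1.1 p.1.2) P

/-- The matrix `X_N = (γ(i,j) x_{i,j} / √N)`, with variance profile `Γ = (γ²(i,j))`. -/
noncomputable def profileMatrix {N : ℕ} {Ω : Type*} (Γ : Matrix (Fin N) (Fin N) ℝ)
    (x : Fin N → Fin N → Ω → ℂ) (ω : Ω) : Matrix (Fin N) (Fin N) ℂ :=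
  Matrix.of fun i j => (√(Γ i j) : ℂ) * x i j ω / (√(N : ℝ) : ℂ)

/-- The operator norm `‖(Im Λ)⁻¹‖`, where `Im Λ = (Λ - Λ*) / (2i)`. -/
noncomputable def invImNorm {N : ℕ} (Λ : Matrix (Fin N) (Fin N) ℂ) : ℝ :=
  ‖(ℑ Λ : Matrix (Fin N) (Fin N) ℂ)⁻¹‖

/-- `Im Λ ≥ c I_N`, in the order of Hermitian matrices. -/
def ImGE {N : ℕ} (Λ : Matrix (Fin N) (Fin N) ℂ) (c : ℝ) : Prop :=
  ((ℑ Λ : Matrix (Fin N) (Fin N) ℂ) - (c : ℂ) • (1 : Matrix (Fin N) (Fin N) ℂ)).PosSemidef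

/-- The error `ε_N(d)` for a general Hermitian matrix `Y_N`, with `g = γ_max` and
`m = ‖(Im Λ)⁻¹‖`. -/
noncomputable def epsGeneral (N : ℕ) (g m δ d : ℝ) : ℝ :=
  √2 * g * √(d * Real.log N / N) * m ^ 2 + (1 + g ^ 2 / δ * m ^ 2) * (2 * g ^ 3 * m ^ 4 / N)

/-- The error `ε_N(d)` for a diagonal matrix `Y_N`, with `g = γ_max` and `m = ‖(Im Λ)⁻¹‖`. -/
noncomputable def epsDiagonal (N : ℕ) (g m δ d : ℝ) : ℝ :=
  √2 * g * √(d * Real.log N / N) * m ^ 2 +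
    (1 + g ^ 2 / δ * m ^ 2) * (g ^ 4 * m ^ 5 / (N : ℝ) ^ (3 / 2 : ℝ))

end DeformedGUE

/-!
Write `T = (Λ - H)⁻¹`, `S(i,j) = γ²(i,j) / N`, `R(w)_i = ∑_j S(i,j) w_j` and `m = ‖(Im Λ)⁻¹‖`. A
diagonal matrix is identified with the vector of its diagonal entries.

**The deterministic equivalent.** On a product of lower half-planes consider the distance
`max_i |w_i - w'_i| / √(Im w_i Im w'_i)`. For `B = (diag(a) - Y)⁻¹` with `Y` Hermitian,
`-Im B_ii = ∑_k Im a_k |B_ik|² = ∑_k Im a_k |B_ki|²`, so by the resolvent identity and the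
Cauchy-Schwarz inequality `a ↦ diag B` does not expand this distance
(`norm_resolvent_diag_sub_le`). Adding `Λ` to `-R(w)` makes it a strict contraction, uniformly for
`Im Λ ≥ η > 0` (`norm_fixMap_sub_le`). Hence the solution `G(Λ)` of the fixed point equation is
unique, it is the locally uniform limit of holomorphic iterates (`differentiableOn_fixedPoint`), and
it is as stable as a resolvent: `‖G(Λ) - G(Λ')‖ ≤ ‖Λ - Λ'‖ ‖(Im Λ)⁻¹‖ ‖(Im Λ')⁻¹‖`
(`norm_fixedPoint_sub_le`).

**Gaussian tools.** Rotating a standard Gaussian vector into an independent copy and integrating by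
parts gives `|Cov(f, h)| ≤ sup |∇f| * 𝔼 |∇h|` (`norm_covariance_le`). With `h = f^(k+1) * conj f^k`
for a centered `f` it bounds the even moments of `|f|`, hence `𝔼 cosh (s |f|) ≤ exp (s² L² / 2)` if
`|∇f| ≤ L`, and `ℙ(|f| ≥ t) ≤ 2 exp (-t² / (2 L²))` (`measureReal_le_norm_centered_le`). Treating the
complex value of `f` at once, rather than its real and imaginary parts, keeps the sharp exponent.

**The mean of the resolvent.** Integration by parts gives
`𝔼 T = B (1 + C)` with `B = (Λ - R(𝔼 diag T) - Y)⁻¹` and `C_ki = Cov(R(diag T)_k, T_ki)`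
(`meanResolvent_eq`). The gradient of `T_ii` is at most `γ_max m² / √N`, and that of `R(diag T)_k` is
at most `γ_max³ m² / N`. So the error `Θ = diag (𝔼 T - B)` is at most `γ_max³ m⁴ / N` in general, and
at most `γ_max⁴ m⁵ / N^(3/2)` if `Y`, hence `B`, is diagonal. Now `diag B` solves the fixed point
equation exactly for the parameter `Λ - R(Θ)`, whose imaginary part is at least `δ / m` by the
assumption on `Λ`, and the stability of the fixed point bounds `𝔼 diag T - G(Λ)`
(`norm_sub_fixedPoint_le`). Concentration of the entries `T_ii` and a union bound conclude.
-/

namespace DeformedGUE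

/-! ### Resolvents with a diagonal spectral parameter -/

section Resolvent

variable {n : Type*} [Fintype n] [DecidableEq n]

/-- The resolvent `(diag(a) - H)⁻¹` of `H` at the diagonal spectral parameter `diag(a)`. -/
noncomputable def resolvent (H : Matrix n n ℂ) (a : n → ℂ) : Matrix n n ℂ :=
  (Matrix.diagonal a - H)⁻¹

lemma im_quadratic_form {H : Matrix n n ℂ} (hH : H.IsHermitian) (a u : n → ℂ) :
    (star u ⬝ᵥ ((Matrix.diagonal a - H).mulVec u)).im = ∑ k, (a k).im * ‖u k‖ ^ 2 := by
  have h0 : (star u ⬝ᵥ H.mulVec u).im = 0 := hH.im_star_dotProduct_mulVec_self u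
  rw [Matrix.sub_mulVec, dotProduct_sub, Complex.sub_im, h0, sub_zero, dotProduct, Complex.im_sum]
  refine Finset.sum_congr rfl fun k _ => ?_
  rw [Matrix.mulVec_diagonal, ← Complex.normSq_eq_norm_sq, Complex.normSq_apply]
  simp only [Pi.star_apply, RCLike.star_def, Complex.mul_im, Complex.mul_re, Complex.conj_re,
    Complex.conj_im]
  ring

lemma isUnit_det_diagonal_sub {H : Matrix n n ℂ} (hH : H.IsHermitian) {a : n → ℂ}
    (ha : ∀ k, 0 < (a k).im) : IsUnit (Matrix.diagonal a - H).det := by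
  rw [isUnit_iff_ne_zero]
  intro h
  obtain ⟨v, hv, hv0⟩ := Matrix.exists_mulVec_eq_zero_iff.mpr h
  have h1 := im_quadratic_form hH a v
  rw [hv0, dotProduct_zero, Complex.zero_im] at h1
  have h2 := (Finset.sum_eq_zero_iff_of_nonneg
    (fun k _ => mul_nonneg (ha k).le (sq_nonneg ‖v k‖))).mp h1.symm
  refine hv (funext fun k => ?_)
  have := h2 k (Finset.mem_univ k)
  simpa [(ha k).ne'] using this

lemma mul_resolvent {H : Matrix n n ℂ} (hH : H.IsHermitian) {a : n → ℂ}
    (ha : ∀ k, 0 < (a k).im) : (Matrix.diagonal a - H) * resolvent H a = 1 :=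
  Matrix.mul_nonsing_inv _ (isUnit_det_diagonal_sub hH ha)

lemma resolvent_mul {H : Matrix n n ℂ} (hH : H.IsHermitian) {a : n → ℂ}
    (ha : ∀ k, 0 < (a k).im) : resolvent H a * (Matrix.diagonal a - H) = 1 :=
  Matrix.nonsing_inv_mul _ (isUnit_det_diagonal_sub hH ha)

lemma resolvent_transpose (H : Matrix n n ℂ) (a : n → ℂ) :
    resolvent H.transpose a = (resolvent H a).transpose := by
  rw [resolvent, resolvent, Matrix.transpose_nonsing_inv, Matrix.transpose_sub,
    Matrix.diagonal_transpose]

lemma neg_im_resolvent_eq_sum_col {H : Matrix n n ℂ} (hH : H.IsHermitian) {a : n → ℂ}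
    (ha : ∀ k, 0 < (a k).im) (i : n) :
    -(resolvent H a i i).im = ∑ k, (a k).im * ‖resolvent H a k i‖ ^ 2 := by
  have h := im_quadratic_form hH a (fun k => resolvent H a k i)
  rw [← h]
  have h1 : (Matrix.diagonal a - H).mulVec (fun k => resolvent H a k i) = Pi.single i 1 := by
    have := congrArg (fun M : Matrix n n ℂ => fun k => M k i) (mul_resolvent hH ha)
    ext k
    have h2 := congrFun this k
    simp only [Matrix.mul_apply] at h2
    rw [Matrix.mulVec, dotProduct, h2, Matrix.one_apply, Pi.single_apply]
  rw [h1, dotProduct_single_one]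
  simp

lemma neg_im_resolvent_eq_sum_row {H : Matrix n n ℂ} (hH : H.IsHermitian) {a : n → ℂ}
    (ha : ∀ k, 0 < (a k).im) (i : n) :
    -(resolvent H a i i).im = ∑ k, (a k).im * ‖resolvent H a i k‖ ^ 2 := by
  have h := neg_im_resolvent_eq_sum_col hH.transpose ha i
  simpa [resolvent_transpose] using h

lemma neg_im_resolvent_pos {H : Matrix n n ℂ} (hH : H.IsHermitian) {a : n → ℂ}
    (ha : ∀ k, 0 < (a k).im) (i : n) : 0 < -(resolvent H a i i).im := by
  rw [neg_im_resolvent_eq_sum_col hH ha i]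
  refine (Finset.sum_nonneg fun k _ => by have := ha k; positivity).lt_of_ne' fun h => ?_
  rw [Finset.sum_eq_zero_iff_of_nonneg (fun k _ => by have := ha k; positivity)] at h
  have h0 : ∀ k, resolvent H a k i = 0 := fun k => by
    simpa [(ha k).ne'] using h k (Finset.mem_univ k)
  have h1 := congrArg (fun M : Matrix n n ℂ => M i i) (mul_resolvent hH ha)
  simp [Matrix.mul_apply, h0] at h1

/-- The resolvent has operator norm at most `η⁻¹` when the imaginary part of the spectral
parameter is at least `η`. -/
lemma sum_norm_sq_resolvent_mul_le {H : Matrix n n ℂ} (hH : H.IsHermitian) {a : n → ℂ} {η : ℝ}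
    (hη : 0 < η) (ha : ∀ k, η ≤ (a k).im) (u : n → ℂ) :
    ∑ k, ‖∑ j, resolvent H a k j * u j‖ ^ 2 ≤ (η⁻¹) ^ 2 * ∑ k, ‖u k‖ ^ 2 := by
  have ha' : ∀ k, 0 < (a k).im := fun k => hη.trans_le (ha k)
  set y : n → ℂ := (resolvent H a).mulVec u with hy
  have hyk : ∀ k, ∑ j, resolvent H a k j * u j = y k := fun k => rfl
  simp only [hyk]
  have h1 := im_quadratic_form hH a y
  have h2 : (Matrix.diagonal a - H).mulVec y = u := by
    rw [hy, Matrix.mulVec_mulVec, mul_resolvent hH ha', Matrix.one_mulVec]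
  rw [h2] at h1
  set A := ∑ k, ‖y k‖ ^ 2 with hA
  set U := ∑ k, ‖u k‖ ^ 2 with hU
  have h3 : η * A ≤ (star y ⬝ᵥ u).im := by
    rw [h1, hA, Finset.mul_sum]
    exact Finset.sum_le_sum fun k _ => mul_le_mul_of_nonneg_right (ha k) (sq_nonneg _)
  have h4 : (star y ⬝ᵥ u).im ≤ ∑ k, ‖y k‖ * ‖u k‖ := by
    refine (Complex.abs_im_le_norm _ |> (le_abs_self _).trans).trans ?_
    refine (norm_sum_le _ _).trans (le_of_eq ?_)
    simp
  have h5 := Finset.sum_mul_sq_le_sq_mul_sq Finset.univ (fun k => ‖y k‖) (fun k => ‖u k‖)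
  have hA0 : 0 ≤ A := Finset.sum_nonneg fun k _ => sq_nonneg _
  have hU0 : 0 ≤ U := Finset.sum_nonneg fun k _ => sq_nonneg _
  have h6 : (η * A) ^ 2 ≤ A * U :=
    (pow_le_pow_left₀ (by positivity) (h3.trans h4) 2).trans h5
  rcases hA0.eq_or_lt with h | h
  · rw [← h]; positivity
  · rw [inv_pow, inv_mul_eq_div, le_div_iff₀ (by positivity)]
    have : A * (A * η ^ 2) ≤ A * U := by nlinarith
    exact le_of_mul_le_mul_left this h

lemma sum_norm_sq_resolvent_col_le {H : Matrix n n ℂ} (hH : H.IsHermitian) {a : n → ℂ} {η : ℝ}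
    (hη : 0 < η) (ha : ∀ k, η ≤ (a k).im) (i : n) :
    ∑ k, ‖resolvent H a k i‖ ^ 2 ≤ (η⁻¹) ^ 2 := by
  have := sum_norm_sq_resolvent_mul_le hH hη ha (Pi.single i 1)
  simpa [Pi.single_apply, apply_ite, ite_pow] using this

lemma sum_norm_sq_resolvent_row_le {H : Matrix n n ℂ} (hH : H.IsHermitian) {a : n → ℂ} {η : ℝ}
    (hη : 0 < η) (ha : ∀ k, η ≤ (a k).im) (i : n) :
    ∑ k, ‖resolvent H a i k‖ ^ 2 ≤ (η⁻¹) ^ 2 := by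
  have := sum_norm_sq_resolvent_col_le hH.transpose hη ha i
  simpa [resolvent_transpose] using this

lemma norm_resolvent_apply_le {H : Matrix n n ℂ} (hH : H.IsHermitian) {a : n → ℂ} {η : ℝ}
    (hη : 0 < η) (ha : ∀ k, η ≤ (a k).im) (i j : n) : ‖resolvent H a i j‖ ≤ η⁻¹ := by
  refine le_of_sq_le_sq ?_ (by positivity)
  exact (Finset.single_le_sum (f := fun k => ‖resolvent H a k j‖ ^ 2)
    (fun k _ => sq_nonneg _) (Finset.mem_univ i)).trans (sum_norm_sq_resolvent_col_le hH hη ha j)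

lemma neg_im_resolvent_le {H : Matrix n n ℂ} (hH : H.IsHermitian) {a : n → ℂ} {η : ℝ}
    (hη : 0 < η) (ha : ∀ k, η ≤ (a k).im) (i : n) : -(resolvent H a i i).im ≤ η⁻¹ :=
  ((neg_le_abs _).trans (Complex.abs_im_le_norm _)).trans (norm_resolvent_apply_le hH hη ha i i)

lemma resolvent_sub_resolvent {H : Matrix n n ℂ} (hH : H.IsHermitian) {a a' : n → ℂ}
    (ha : ∀ k, 0 < (a k).im) (ha' : ∀ k, 0 < (a' k).im) (i j : n) :
    resolvent H a i j - resolvent H a' i j =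
      ∑ k, resolvent H a i k * (a' k - a k) * resolvent H a' k j := by
  have h : resolvent H a - resolvent H a' =
      resolvent H a * Matrix.diagonal (a' - a) * resolvent H a' := by
    have h1 : Matrix.diagonal (a' - a) =
        (Matrix.diagonal a' - H) - (Matrix.diagonal a - H) := by
      rw [sub_sub_sub_cancel_right, Matrix.diagonal_sub]; rfl
    rw [h1, mul_sub, sub_mul, mul_assoc, mul_resolvent hH ha', resolvent_mul hH ha, mul_one,
      one_mul]
  have h2 := congrArg (fun M : Matrix n n ℂ => M i j) h
  simp only [Matrix.sub_apply, Matrix.mul_apply (M := resolvent H a * _), Matrix.mul_diagonal] at h2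
  simpa using h2

lemma differentiableAt_resolvent {H : Matrix n n ℂ} (hH : H.IsHermitian)
    {E : Type*} [NormedAddCommGroup E] [NormedSpace ℂ E] {a : E → n → ℂ} {x : E}
    (ha : DifferentiableAt ℂ a x) (hx : ∀ k, 0 < (a x k).im) (i j : n) :
    DifferentiableAt ℂ (fun y => resolvent H (a y) i j) x := by
  have h1 : DifferentiableAt ℂ (fun y => Matrix.diagonal (a y) - H) x :=
    ((Matrix.diagonalLinearMap n ℂ ℂ).toContinuousLinearMap.differentiableAt.comp x ha).sub_const H
  have h2 : IsUnit (Matrix.diagonal (a x) - H) :=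
    (Matrix.isUnit_iff_isUnit_det _).mpr (isUnit_det_diagonal_sub hH hx)
  have h3 := (differentiableAt_inverse (𝕜 := ℂ) h2).comp x h1
  have h4 := (Matrix.entryLinearMap ℂ ℂ i j).toContinuousLinearMap.differentiableAt.comp x h3
  refine h4.congr_of_eventuallyEq (Filter.Eventually.of_forall fun y => ?_)
  simp [resolvent, Matrix.nonsing_inv_eq_ringInverse]

lemma continuousAt_resolvent {H : Matrix n n ℂ} (hH : H.IsHermitian) {a : n → ℂ}
    (ha : ∀ k, 0 < (a k).im) (i j : n) : ContinuousAt (fun b => resolvent H b i j) a :=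
  (differentiableAt_resolvent hH differentiableAt_id ha i j).continuousAt

end Resolvent

/-! ### Contraction of the fixed point map in a hyperbolic metric -/

section FixedPoint

variable {n : Type*} [Fintype n]

/-- The weighted average `i ↦ ∑ j, S i j * w j`. -/
noncomputable def wavg (S : Matrix n n ℝ) (w : n → ℂ) (i : n) : ℂ := ∑ j, (S i j : ℂ) * w j

/-- The spectral parameter `a - R(w)` of the fixed point equation, where `R` is `wavg S`. -/
noncomputable def shift (S : Matrix n n ℝ) (a w : n → ℂ) (i : n) : ℂ := a i - wavg S w i

lemma im_shift (S : Matrix n n ℝ) (a w : n → ℂ) (i : n) :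
    (shift S a w i).im = (a i).im + ∑ j, S i j * -(w j).im := by
  simp [shift, wavg, Finset.sum_neg_distrib, sub_eq_add_neg]

lemma im_le_im_shift {S : Matrix n n ℝ} (hS : ∀ i j, 0 ≤ S i j) {a w : n → ℂ}
    (hw : ∀ j, (w j).im ≤ 0) (i : n) : (a i).im ≤ (shift S a w i).im := by
  rw [im_shift]
  exact le_add_of_nonneg_right
    (Finset.sum_nonneg fun j _ => mul_nonneg (hS i j) (neg_nonneg.mpr (hw j)))

lemma im_shift_pos {S : Matrix n n ℝ} (hS : ∀ i j, 0 ≤ S i j) {a w : n → ℂ}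
    (ha : ∀ i, 0 < (a i).im) (hw : ∀ j, (w j).im ≤ 0) (i : n) : 0 < (shift S a w i).im :=
  (ha i).trans_le (im_le_im_shift hS hw i)

lemma norm_wavg_le {S : Matrix n n ℝ} (hS : ∀ i j, 0 ≤ S i j) {w : n → ℂ} {ε : ℝ}
    (hw : ∀ j, ‖w j‖ ≤ ε) (i : n) : ‖wavg S w i‖ ≤ (∑ j, S i j) * ε := by
  rw [Finset.sum_mul]
  refine (norm_sum_le _ _).trans (Finset.sum_le_sum fun j _ => ?_)
  rw [norm_mul, Complex.norm_real, Real.norm_of_nonneg (hS i j)]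
  exact mul_le_mul_of_nonneg_left (hw j) (hS i j)

lemma sqrt_mul_add_sqrt_mul_le {x x' y y' : ℝ} (hx : 0 ≤ x) (hx' : 0 ≤ x') (hy : 0 ≤ y)
    (hy' : 0 ≤ y') : √(x * x') + √(y * y') ≤ √((x + y) * (x' + y')) := by
  refine Real.le_sqrt_of_sq_le ?_
  have h1 := Real.sq_sqrt (mul_nonneg hx hx')
  have h2 := Real.sq_sqrt (mul_nonneg hy hy')
  have h3 : √(x * x') * √(y * y') = √(x * y') * √(y * x') := by
    rw [← Real.sqrt_mul (by positivity), ← Real.sqrt_mul (by positivity)]; ring_nf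
  have h4 := Real.sq_sqrt (mul_nonneg hx hy')
  have h5 := Real.sq_sqrt (mul_nonneg hy hx')
  nlinarith [sq_nonneg (√(x * y') - √(y * x'))]

lemma sum_mul_le_sqrt {ι : Type*} (s : Finset ι) (f g : ι → ℝ) :
    ∑ i ∈ s, f i * g i ≤ √((∑ i ∈ s, f i ^ 2) * ∑ i ∈ s, g i ^ 2) :=
  Real.le_sqrt_of_sq_le (Finset.sum_mul_sq_le_sq_mul_sq s f g)

variable [DecidableEq n]

/-- The diagonal of the resolvent does not expand the distance
`max_k |a k - a' k| / √(Im a k * Im a' k)`, which is a function of the hyperbolic distance on a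
product of half-planes. -/
lemma norm_resolvent_diag_sub_le {H : Matrix n n ℂ} (hH : H.IsHermitian) {a a' : n → ℂ}
    (ha : ∀ k, 0 < (a k).im) (ha' : ∀ k, 0 < (a' k).im) {t : ℝ} (ht : 0 ≤ t)
    (h : ∀ k, ‖a k - a' k‖ ≤ t * √((a k).im * (a' k).im)) (i : n) :
    ‖resolvent H a i i - resolvent H a' i i‖ ≤
      t * √(-(resolvent H a i i).im * -(resolvent H a' i i).im) := by
  rw [resolvent_sub_resolvent hH ha ha', neg_im_resolvent_eq_sum_row hH ha,
    neg_im_resolvent_eq_sum_col hH ha']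
  calc ‖∑ k, resolvent H a i k * (a' k - a k) * resolvent H a' k i‖
      ≤ ∑ k, t * ((√(a k).im * ‖resolvent H a i k‖) * (√(a' k).im * ‖resolvent H a' k i‖)) := by
        refine (norm_sum_le _ _).trans (Finset.sum_le_sum fun k _ => ?_)
        rw [norm_mul, norm_mul, norm_sub_rev]
        calc _ ≤ ‖resolvent H a i k‖ * (t * √((a k).im * (a' k).im)) * ‖resolvent H a' k i‖ := by
              gcongr; exact h k
          _ = _ := by rw [Real.sqrt_mul (ha k).le]; ring
    _ ≤ _ := by
        rw [← Finset.mul_sum]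
        refine mul_le_mul_of_nonneg_left ((sum_mul_le_sqrt _ _ _).trans (le_of_eq ?_)) ht
        simp only [mul_pow]
        congr 2 <;> exact Finset.sum_congr rfl fun k _ => by
          rw [Real.sq_sqrt]; first | exact (ha k).le | exact (ha' k).le

/-- The map `w ↦ diag (diag(a) - R(w) - H)⁻¹` whose fixed point is sought. -/
noncomputable def fixMap (S : Matrix n n ℝ) (H : Matrix n n ℂ) (a w : n → ℂ) (i : n) : ℂ :=
  resolvent H (shift S a w) i i

/-- The fixed point map contracts the distance `max_k |w k - w' k| / √(Im w k * Im w' k)` by the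
factor `θ`, up to the effect `c` of a change of the spectral parameter. -/
lemma norm_fixMap_sub_le {S : Matrix n n ℝ} (hS : ∀ i j, 0 ≤ S i j) {H : Matrix n n ℂ}
    (hH : H.IsHermitian) {a a' w w' : n → ℂ} (ha : ∀ k, 0 < (a k).im) (ha' : ∀ k, 0 < (a' k).im)
    (hw : ∀ k, (w k).im ≤ 0) (hw' : ∀ k, (w' k).im ≤ 0) {c t θ : ℝ} (hc : 0 ≤ c) (hct : c ≤ t)
    (hθ0 : 0 ≤ θ)
    (haa : ∀ k, ‖a k - a' k‖ ≤ c * √((a k).im * (a' k).im))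
    (hww : ∀ k, ‖w k - w' k‖ ≤ t * √(-(w k).im * -(w' k).im))
    (hθ : ∀ k, ∑ j, S k j * -(w j).im ≤ θ * (shift S a w k).im)
    (hθ' : ∀ k, ∑ j, S k j * -(w' j).im ≤ θ * (shift S a' w' k).im) (i : n) :
    ‖fixMap S H a w i - fixMap S H a' w' i‖ ≤
      (c + (t - c) * θ) * √(-(fixMap S H a w i).im * -(fixMap S H a' w' i).im) := by
  have ht : 0 ≤ t := hc.trans hct
  have hv : ∀ k, 0 ≤ -(w k).im := fun k => neg_nonneg.mpr (hw k)
  have hv' : ∀ k, 0 ≤ -(w' k).im := fun k => neg_nonneg.mpr (hw' k)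
  refine norm_resolvent_diag_sub_le hH (im_shift_pos hS ha hw) (im_shift_pos hS ha' hw')
    (add_nonneg hc (mul_nonneg (sub_nonneg.mpr hct) hθ0)) (fun k => ?_) i
  set r := ∑ j, S k j * -(w j).im with hr
  set r' := ∑ j, S k j * -(w' j).im with hr'
  have hr0 : 0 ≤ r := Finset.sum_nonneg fun j _ => mul_nonneg (hS k j) (hv j)
  have hr0' : 0 ≤ r' := Finset.sum_nonneg fun j _ => mul_nonneg (hS k j) (hv' j)
  have h1 : ‖wavg S w k - wavg S w' k‖ ≤ t * √(r * r') := by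
    have : wavg S w k - wavg S w' k = ∑ j, (S k j : ℂ) * (w j - w' j) := by
      simp [wavg, mul_sub, Finset.sum_sub_distrib]
    rw [this]
    calc _ ≤ ∑ j, t * (√(S k j * -(w j).im) * √(S k j * -(w' j).im)) := by
          refine (norm_sum_le _ _).trans (Finset.sum_le_sum fun j _ => ?_)
          rw [norm_mul, Complex.norm_real, Real.norm_of_nonneg (hS k j),
            ← Real.sqrt_mul (mul_nonneg (hS k j) (hv j))]
          have h2 : S k j * -(w j).im * (S k j * -(w' j).im) =
              S k j ^ 2 * (-(w j).im * -(w' j).im) := by ring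
          rw [h2, Real.sqrt_mul (sq_nonneg _), Real.sqrt_sq (hS k j)]
          nlinarith [mul_le_mul_of_nonneg_left (hww j) (hS k j)]
      _ ≤ _ := by
          rw [← Finset.mul_sum]
          refine mul_le_mul_of_nonneg_left ((sum_mul_le_sqrt _ _ _).trans (le_of_eq ?_)) ht
          congr 2 <;> exact Finset.sum_congr rfl fun j _ => by
            rw [Real.sq_sqrt]
            first | exact mul_nonneg (hS k j) (hv j) | exact mul_nonneg (hS k j) (hv' j)
  have h2 : ‖shift S a w k - shift S a' w' k‖ ≤
      c * √((a k).im * (a' k).im) + t * √(r * r') := by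
    have : shift S a w k - shift S a' w' k = (a k - a' k) - (wavg S w k - wavg S w' k) := by
      simp only [shift]; ring
    rw [this]
    exact (norm_sub_le _ _).trans (add_le_add (haa k) h1)
  have h3 := sqrt_mul_add_sqrt_mul_le (ha k).le (ha' k).le hr0 hr0'
  rw [hr, ← im_shift, ← hr, hr', ← im_shift, ← hr'] at h3
  have hp := (im_shift_pos hS ha hw k).le
  have hp' := (im_shift_pos hS ha' hw' k).le
  have h4 : √(r * r') ≤ θ * √((shift S a w k).im * (shift S a' w' k).im) := by
    have : r * r' ≤ θ ^ 2 * ((shift S a w k).im * (shift S a' w' k).im) := by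
      calc r * r' ≤ (θ * (shift S a w k).im) * (θ * (shift S a' w' k).im) :=
            mul_le_mul (hθ k) (hθ' k) hr0' (mul_nonneg hθ0 hp)
        _ = _ := by ring
    refine (Real.sqrt_le_sqrt this).trans (le_of_eq ?_)
    rw [Real.sqrt_mul (sq_nonneg _), Real.sqrt_sq hθ0]
  nlinarith [mul_le_mul_of_nonneg_left h3 hc, mul_le_mul_of_nonneg_left h4 (sub_nonneg.mpr hct)]

lemma le_div_mul_of_le {r R η p : ℝ} (hR : 0 ≤ R) (hη : 0 < η) (hr : r ≤ R) (hp : η ≤ p) :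
    r ≤ R / (η + R) * (p + r) := by
  rw [div_mul_eq_mul_div, le_div_iff₀ (by positivity)]
  nlinarith

/-- **Stability of the fixed point.** Solutions of the fixed point equation for two spectral
parameters are Lipschitz close, with the same constant as resolvents of a Hermitian matrix. -/
lemma norm_fixedPoint_sub_le {S : Matrix n n ℝ} (hS : ∀ i j, 0 ≤ S i j) {H : Matrix n n ℂ}
    (hH : H.IsHermitian) {a a' w w' : n → ℂ} {η η' ε : ℝ} (hη : 0 < η) (hη' : 0 < η')
    (ha : ∀ k, η ≤ (a k).im) (ha' : ∀ k, η' ≤ (a' k).im)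
    (hw : ∀ k, (w k).im < 0) (hw' : ∀ k, (w' k).im < 0)
    (hfix : ∀ k, fixMap S H a w k = w k) (hfix' : ∀ k, fixMap S H a' w' k = w' k)
    (haa : ∀ k, ‖a k - a' k‖ ≤ ε) (i : n) :
    ‖w i - w' i‖ ≤ ε * (η⁻¹ * η'⁻¹) := by
  have hap : ∀ k, 0 < (a k).im := fun k => hη.trans_le (ha k)
  have hap' : ∀ k, 0 < (a' k).im := fun k => hη'.trans_le (ha' k)
  have hv : ∀ k, 0 < -(w k).im := fun k => neg_pos.mpr (hw k)
  have hv' : ∀ k, 0 < -(w' k).im := fun k => neg_pos.mpr (hw' k)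
  have hε : 0 ≤ ε := (norm_nonneg _).trans (haa i)
  set c := ε / √(η * η') with hc
  have hc0 : 0 ≤ c := by positivity
  have hcε : ∀ k, ‖a k - a' k‖ ≤ c * √((a k).im * (a' k).im) := fun k => by
    have h1 : √(η * η') ≤ √((a k).im * (a' k).im) :=
      Real.sqrt_le_sqrt (mul_le_mul (ha k) (ha' k) hη'.le (hap k).le)
    have h2 : 0 < √(η * η') := Real.sqrt_pos.mpr (by positivity)
    calc ‖a k - a' k‖ ≤ ε := haa k
      _ = c * √(η * η') := by rw [hc]; field_simp
      _ ≤ _ := mul_le_mul_of_nonneg_left h1 hc0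
  obtain ⟨i₀, -, hi₀⟩ := Finset.exists_max_image Finset.univ
    (fun k => ‖w k - w' k‖ / √(-(w k).im * -(w' k).im)) ⟨i, Finset.mem_univ i⟩
  set t := ‖w i₀ - w' i₀‖ / √(-(w i₀).im * -(w' i₀).im) with ht
  have hsq : ∀ k, 0 < √(-(w k).im * -(w' k).im) := fun k =>
    Real.sqrt_pos.mpr (mul_pos (hv k) (hv' k))
  have hww : ∀ k, ‖w k - w' k‖ ≤ t * √(-(w k).im * -(w' k).im) := fun k =>
    (div_le_iff₀ (hsq k)).mp (hi₀ k (Finset.mem_univ k))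
  -- the distance `t` between the solutions is at most the distance `c` between the parameters,
  -- since otherwise the contraction would decrease it
  have htc : t ≤ c := by
    by_contra! hlt
    set R := ∑ k, ∑ j, (S k j * -(w j).im + S k j * -(w' j).im) with hR
    have hnn : ∀ k j, 0 ≤ S k j * -(w j).im := fun k j => mul_nonneg (hS k j) (hv j).le
    have hnn' : ∀ k j, 0 ≤ S k j * -(w' j).im := fun k j => mul_nonneg (hS k j) (hv' j).le
    have hRk : ∀ k, ∑ j, (S k j * -(w j).im + S k j * -(w' j).im) ≤ R := fun k =>
      Finset.single_le_sum (f := fun k => ∑ j, (S k j * -(w j).im + S k j * -(w' j).im))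
        (fun k _ => Finset.sum_nonneg fun j _ => add_nonneg (hnn k j) (hnn' k j))
        (Finset.mem_univ k)
    have hR0 : 0 ≤ R := Finset.sum_nonneg fun k _ => Finset.sum_nonneg fun j _ =>
      add_nonneg (hnn k j) (hnn' k j)
    set η₀ := min η η' with hη₀
    have hη₀pos : 0 < η₀ := lt_min hη hη'
    have hθ1 : R / (η₀ + R) < 1 := by rw [div_lt_one (by positivity)]; linarith
    have key := norm_fixMap_sub_le hS hH hap hap' (fun k => (hw k).le) (fun k => (hw' k).le)
      hc0 hlt.le (θ := R / (η₀ + R)) (by positivity) hcε hww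
      (fun k => by
        rw [im_shift]
        refine le_div_mul_of_le hR0 hη₀pos (le_trans ?_ (hRk k)) ((min_le_left _ _).trans (ha k))
        exact Finset.sum_le_sum fun j _ => le_add_of_nonneg_right (hnn' k j))
      (fun k => by
        rw [im_shift]
        refine le_div_mul_of_le hR0 hη₀pos (le_trans ?_ (hRk k)) ((min_le_right _ _).trans (ha' k))
        exact Finset.sum_le_sum fun j _ => le_add_of_nonneg_left (hnn k j)) i₀
    rw [hfix, hfix', ← div_le_iff₀ (hsq i₀), ← ht] at key
    nlinarith
  have hb : -(w i).im ≤ η⁻¹ := by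
    rw [← hfix i]
    exact neg_im_resolvent_le hH hη (fun k => (ha k).trans (im_le_im_shift hS (fun k => (hw k).le) k)) i
  have hb' : -(w' i).im ≤ η'⁻¹ := by
    rw [← hfix' i]
    exact neg_im_resolvent_le hH hη'
      (fun k => (ha' k).trans (im_le_im_shift hS (fun k => (hw' k).le) k)) i
  calc ‖w i - w' i‖ ≤ c * √(-(w i).im * -(w' i).im) :=
        (hww i).trans (mul_le_mul_of_nonneg_right htc (hsq i).le)
    _ ≤ c * √(η⁻¹ * η'⁻¹) := by
        refine mul_le_mul_of_nonneg_left (Real.sqrt_le_sqrt ?_) hc0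
        exact mul_le_mul hb hb' (hv' i).le (by positivity)
    _ = ε * (η⁻¹ * η'⁻¹) := by
        rw [hc, ← mul_inv, Real.sqrt_inv, div_mul_eq_mul_div, mul_div_assoc, ← one_div, div_div,
          Real.mul_self_sqrt (by positivity)]
        simp

lemma fixedPoint_unique {S : Matrix n n ℝ} (hS : ∀ i j, 0 ≤ S i j) {H : Matrix n n ℂ}
    (hH : H.IsHermitian) {a w w' : n → ℂ} (ha : ∀ k, 0 < (a k).im)
    (hw : ∀ k, (w k).im < 0) (hw' : ∀ k, (w' k).im < 0)
    (hfix : ∀ k, fixMap S H a w k = w k) (hfix' : ∀ k, fixMap S H a w' k = w' k) : w = w' := by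
  funext i
  obtain ⟨i₀, -, hi₀⟩ := Finset.exists_min_image Finset.univ (fun k => (a k).im)
    ⟨i, Finset.mem_univ i⟩
  have h := norm_fixedPoint_sub_le hS hH (ha i₀) (ha i₀) (fun k => hi₀ k (Finset.mem_univ k))
    (fun k => hi₀ k (Finset.mem_univ k)) hw hw' hfix hfix' (ε := 0) (by simp) i
  rw [zero_mul] at h
  exact sub_eq_zero.mp (norm_le_zero_iff.mp h)

/-! ### Convergence of the iterates and analyticity of the fixed point -/

/-- The iterates of the fixed point map started at `-i`. -/
noncomputable def picard (S : Matrix n n ℝ) (H : Matrix n n ℂ) (a : n → ℂ) : ℕ → n → ℂ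
  | 0 => fun _ => -Complex.I
  | m + 1 => fixMap S H a (picard S H a m)

lemma im_picard_neg {S : Matrix n n ℝ} (hS : ∀ i j, 0 ≤ S i j) {H : Matrix n n ℂ}
    (hH : H.IsHermitian) {a : n → ℂ} (ha : ∀ k, 0 < (a k).im) (m : ℕ) (k : n) :
    (picard S H a m k).im < 0 := by
  induction m generalizing k with
  | zero => simp [picard]
  | succ m ih =>
    exact neg_pos.mp (neg_im_resolvent_pos hH (im_shift_pos hS ha fun j => (ih j).le) k)

lemma neg_im_picard_le {S : Matrix n n ℝ} (hS : ∀ i j, 0 ≤ S i j) {H : Matrix n n ℂ}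
    (hH : H.IsHermitian) {a : n → ℂ} {η : ℝ} (hη : 0 < η) (ha : ∀ k, η ≤ (a k).im) (m : ℕ)
    (k : n) : -(picard S H a m k).im ≤ 1 + η⁻¹ := by
  have hη' : 0 < η⁻¹ := by positivity
  cases m with
  | zero => simp [picard, hη'.le]
  | succ m =>
    refine (neg_im_resolvent_le hH hη (fun k => (ha k).trans
      (im_le_im_shift hS (fun j => (im_picard_neg hS hH (fun k => hη.trans_le (ha k)) m j).le) k))
      k).trans (by linarith)

/-- The distance between the first two iterates. -/
noncomputable def picardGap (S : Matrix n n ℝ) (H : Matrix n n ℂ) (a : n → ℂ) : ℝ :=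
  ∑ k, ‖picard S H a 0 k - picard S H a 1 k‖ / √(-(picard S H a 1 k).im)

lemma norm_picard_sub_le {S : Matrix n n ℝ} (hS : ∀ i j, 0 ≤ S i j) {H : Matrix n n ℂ}
    (hH : H.IsHermitian) {a : n → ℂ} {η ρ : ℝ} (hη : 0 < η) (ha : ∀ k, η ≤ (a k).im)
    (hρ : ∀ k, ∑ j, S k j ≤ ρ) (hρ0 : 0 ≤ ρ) (m : ℕ) (k : n) :
    ‖picard S H a m k - picard S H a (m + 1) k‖ ≤
      (picardGap S H a * (1 + η⁻¹)) * (ρ * (1 + η⁻¹) / (η + ρ * (1 + η⁻¹))) ^ m := by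
  have hap : ∀ k, 0 < (a k).im := fun k => hη.trans_le (ha k)
  have hneg := im_picard_neg hS hH hap
  have hle := neg_im_picard_le hS hH hη ha
  set V := 1 + η⁻¹ with hV
  have hV0 : 0 < V := by positivity
  set θ := ρ * V / (η + ρ * V) with hθ
  have hθ0 : 0 ≤ θ := by positivity
  have hgap : 0 ≤ picardGap S H a := Finset.sum_nonneg fun k _ => by positivity
  have hsum : ∀ m k, ∑ j, S k j * -(picard S H a m j).im ≤ ρ * V := fun m k => by
    refine le_trans (Finset.sum_le_sum fun j _ => mul_le_mul_of_nonneg_left (hle m j) (hS k j)) ?_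
    rw [← Finset.sum_mul]
    exact mul_le_mul_of_nonneg_right (hρ k) hV0.le
  have main : ∀ m k, ‖picard S H a m k - picard S H a (m + 1) k‖ ≤
      (picardGap S H a * θ ^ m) *
        √(-(picard S H a m k).im * -(picard S H a (m + 1) k).im) := by
    intro m
    induction m with
    | zero =>
      intro k
      have h1 : 0 < √(-(picard S H a 1 k).im) := Real.sqrt_pos.mpr (neg_pos.mpr (hneg 1 k))
      have h2 : -(picard S H a 0 k).im = 1 := by simp [picard]
      rw [h2, one_mul, pow_zero, mul_one, zero_add, ← div_le_iff₀ h1]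
      exact Finset.single_le_sum
        (f := fun k => ‖picard S H a 0 k - picard S H a 1 k‖ / √(-(picard S H a 1 k).im))
        (fun k _ => by positivity) (Finset.mem_univ k)
    | succ m ih =>
      intro k
      have h := norm_fixMap_sub_le hS hH hap hap (fun k => (hneg m k).le)
        (fun k => (hneg (m + 1) k).le) le_rfl (by positivity) hθ0 (by simp) ih
        (fun k => by
          rw [im_shift]; exact le_div_mul_of_le (by positivity) hη (hsum m k) (ha k))
        (fun k => by
          rw [im_shift]; exact le_div_mul_of_le (by positivity) hη (hsum (m + 1) k) (ha k)) k
      rw [zero_add, sub_zero] at h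
      rw [pow_succ, ← mul_assoc]
      exact h
  refine (main m k).trans ?_
  have h1 : √(-(picard S H a m k).im * -(picard S H a (m + 1) k).im) ≤ V := by
    rw [Real.sqrt_le_left hV0.le, sq]
    exact mul_le_mul (hle _ _) (hle _ _) (neg_pos.mpr (hneg _ _)).le hV0.le
  calc _ ≤ (picardGap S H a * θ ^ m) * V := mul_le_mul_of_nonneg_left h1 (by positivity)
    _ = _ := by ring

end FixedPoint

section FixedPointLimit

open Filter Topology

variable {n : Type*} [Fintype n]

lemma row_sum_le_sum {S : Matrix n n ℝ} (hS : ∀ i j, 0 ≤ S i j) (k : n) :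
    ∑ j, S k j ≤ ∑ i, ∑ j, S i j :=
  Finset.single_le_sum (f := fun k => ∑ j, S k j)
    (fun k _ => Finset.sum_nonneg fun j _ => hS k j) (Finset.mem_univ k)

lemma sum_sum_nonneg {S : Matrix n n ℝ} (hS : ∀ i j, 0 ≤ S i j) : 0 ≤ ∑ i, ∑ j, S i j :=
  Finset.sum_nonneg fun k _ => Finset.sum_nonneg fun j _ => hS k j

lemma exists_pos_le_im {a : n → ℂ} (ha : ∀ k, 0 < (a k).im) : ∃ η > 0, ∀ k, η ≤ (a k).im := by
  rcases isEmpty_or_nonempty n with h | h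
  · exact ⟨1, one_pos, fun k => h.elim k⟩
  · obtain ⟨i₀, hi₀⟩ := Finite.exists_min fun k => (a k).im
    exact ⟨(a i₀).im, ha i₀, hi₀⟩

variable [DecidableEq n]

/-- The solution of the fixed point equation, as the limit of the iterates. -/
noncomputable def fixedPoint (S : Matrix n n ℝ) (H : Matrix n n ℂ) (a : n → ℂ) (k : n) : ℂ :=
  limUnder atTop fun m => picard S H a m k

/-- The contraction factor of the fixed point map when `Im a ≥ η` and the row sums of `S` are at
most `ρ`. -/
noncomputable def contractionFactor (ρ η : ℝ) : ℝ := ρ * (1 + η⁻¹) / (η + ρ * (1 + η⁻¹))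

lemma contractionFactor_nonneg {ρ η : ℝ} (hρ : 0 ≤ ρ) (hη : 0 < η) :
    0 ≤ contractionFactor ρ η := by
  unfold contractionFactor; positivity

lemma contractionFactor_lt_one {ρ η : ℝ} (hρ : 0 ≤ ρ) (hη : 0 < η) :
    contractionFactor ρ η < 1 := by
  unfold contractionFactor
  rw [div_lt_one (by positivity)]
  linarith

lemma tendsto_picard {S : Matrix n n ℝ} (hS : ∀ i j, 0 ≤ S i j) {H : Matrix n n ℂ}
    (hH : H.IsHermitian) {a : n → ℂ} {η ρ : ℝ} (hη : 0 < η) (ha : ∀ k, η ≤ (a k).im)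
    (hρ : ∀ k, ∑ j, S k j ≤ ρ) (hρ0 : 0 ≤ ρ) (k : n) :
    Tendsto (fun m => picard S H a m k) atTop (𝓝 (fixedPoint S H a k)) :=
  (cauchySeq_of_le_geometric _ _ (contractionFactor_lt_one hρ0 hη) fun m => by
    rw [dist_eq_norm]; exact norm_picard_sub_le hS hH hη ha hρ hρ0 m k).tendsto_limUnder

lemma dist_picard_fixedPoint_le {S : Matrix n n ℝ} (hS : ∀ i j, 0 ≤ S i j) {H : Matrix n n ℂ}
    (hH : H.IsHermitian) {a : n → ℂ} {η ρ : ℝ} (hη : 0 < η) (ha : ∀ k, η ≤ (a k).im)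
    (hρ : ∀ k, ∑ j, S k j ≤ ρ) (hρ0 : 0 ≤ ρ) (m : ℕ) (k : n) :
    dist (picard S H a m k) (fixedPoint S H a k) ≤
      picardGap S H a * (1 + η⁻¹) * contractionFactor ρ η ^ m / (1 - contractionFactor ρ η) :=
  dist_le_of_le_geometric_of_tendsto _ _ (contractionFactor_lt_one hρ0 hη) (fun m => by
    rw [dist_eq_norm]; exact norm_picard_sub_le hS hH hη ha hρ hρ0 m k)
    (tendsto_picard hS hH hη ha hρ hρ0 k) m

lemma fixedPoint_spec {S : Matrix n n ℝ} (hS : ∀ i j, 0 ≤ S i j) {H : Matrix n n ℂ}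
    (hH : H.IsHermitian) {a : n → ℂ} (ha : ∀ k, 0 < (a k).im) :
    (∀ k, (fixedPoint S H a k).im < 0) ∧ ∀ k, fixMap S H a (fixedPoint S H a) k =
      fixedPoint S H a k := by
  obtain ⟨η, hη, hηa⟩ := exists_pos_le_im ha
  have ht := tendsto_picard hS hH hη hηa (row_sum_le_sum hS) (sum_sum_nonneg hS)
  have him : ∀ k, (fixedPoint S H a k).im ≤ 0 := fun k =>
    le_of_tendsto ((Complex.continuous_im.tendsto _).comp (ht k))
      (Eventually.of_forall fun m => (im_picard_neg hS hH ha m k).le)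
  have hpos := im_shift_pos hS ha him
  have hshift : Tendsto (fun m => shift S a (picard S H a m)) atTop
      (𝓝 (shift S a (fixedPoint S H a))) := by
    refine tendsto_pi_nhds.mpr fun i => tendsto_const_nhds.sub ?_
    exact tendsto_finsetSum _ fun j _ => (ht j).const_mul _
  have hfix : ∀ k, fixMap S H a (fixedPoint S H a) k = fixedPoint S H a k := fun k =>
    tendsto_nhds_unique ((continuousAt_resolvent hH hpos k k).tendsto.comp hshift)
      ((ht k).comp (tendsto_add_atTop_nat 1))
  refine ⟨fun k => ?_, hfix⟩
  rw [← hfix k]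
  exact neg_pos.mp (neg_im_resolvent_pos hH hpos k)

lemma differentiableAt_picard {S : Matrix n n ℝ} (hS : ∀ i j, 0 ≤ S i j) {H : Matrix n n ℂ}
    (hH : H.IsHermitian) {a : ℂ → n → ℂ} {z : ℂ} (ha : DifferentiableAt ℂ a z)
    (hz : ∀ k, 0 < (a z k).im) (m : ℕ) :
    DifferentiableAt ℂ (fun y => picard S H (a y) m) z := by
  induction m with
  | zero => exact differentiableAt_const _
  | succ m ih =>
    refine differentiableAt_pi.mpr fun k => ?_
    have h1 : DifferentiableAt ℂ (fun y => shift S (a y) (picard S H (a y) m)) z := by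
      rw [differentiableAt_pi] at ih ha ⊢
      exact fun i => (ha i).sub (DifferentiableAt.fun_sum fun j _ => (ih j).const_mul _)
    exact differentiableAt_resolvent hH h1
      (im_shift_pos hS hz fun j => (im_picard_neg hS hH hz m j).le) k k

/-- The fixed point depends holomorphically on the spectral parameter: the iterates converge
locally uniformly. -/
lemma differentiableOn_fixedPoint {S : Matrix n n ℝ} (hS : ∀ i j, 0 ≤ S i j) {H : Matrix n n ℂ}
    (hH : H.IsHermitian) {a : ℂ → n → ℂ} {U : Set ℂ} (hU : IsOpen U)
    (ha : DifferentiableOn ℂ a U) (hpos : ∀ z ∈ U, ∀ k, 0 < (a z k).im) (k : n) :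
    DifferentiableOn ℂ (fun z => fixedPoint S H (a z) k) U := by
  have hda : ∀ z ∈ U, DifferentiableAt ℂ a z := fun z hz =>
    (ha z hz).differentiableAt (hU.mem_nhds hz)
  have hpic : ∀ m, ∀ z ∈ U, DifferentiableAt ℂ (fun y => picard S H (a y) m) z := fun m z hz =>
    differentiableAt_picard hS hH (hda z hz) (hpos z hz) m
  refine TendstoLocallyUniformlyOn.differentiableOn (φ := atTop)
    (F := fun m z => picard S H (a z) m k) ?_
    (Eventually.of_forall fun m z hz =>
      (differentiableAt_pi.mp (hpic m z hz) k).differentiableWithinAt) hU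
  rw [Metric.tendstoLocallyUniformlyOn_iff]
  intro ε hε z hz
  obtain ⟨η, hη, hηz⟩ := exists_pos_le_im (hpos z hz)
  set ρ := ∑ i, ∑ j, S i j with hρ
  have hρ0 : 0 ≤ ρ := sum_sum_nonneg hS
  have hgap : ContinuousAt (fun y => picardGap S H (a y)) z := by
    refine tendsto_finsetSum _ fun j _ => ContinuousAt.div ?_ ?_ ?_
    · exact ((differentiableAt_pi.mp (hpic 0 z hz) j).continuousAt.sub
        (differentiableAt_pi.mp (hpic 1 z hz) j).continuousAt).norm
    · exact (Complex.continuous_im.continuousAt.comp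
        (differentiableAt_pi.mp (hpic 1 z hz) j).continuousAt).neg.sqrt
    · exact (Real.sqrt_pos.mpr (neg_pos.mpr (im_picard_neg hS hH (hpos z hz) 1 j))).ne'
  set C := picardGap S H (a z) + 1 with hC
  have h1 : ∀ᶠ y in 𝓝 z, picardGap S H (a y) < C := hgap.eventually_lt_const (by linarith)
  have h2 : ∀ᶠ y in 𝓝 z, ∀ j, η / 2 < (a y j).im := by
    refine eventually_all.mpr fun j => ?_
    refine (Complex.continuous_im.continuousAt.comp
      (differentiableAt_pi.mp (hda z hz) j).continuousAt).eventually_const_lt ?_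
    exact lt_of_lt_of_le (by linarith) (hηz j)
  set θ := contractionFactor ρ (η / 2) with hθ
  have hη2 : 0 < η / 2 := by positivity
  have hθ0 : 0 ≤ θ := contractionFactor_nonneg hρ0 hη2
  have hθ1 : θ < 1 := contractionFactor_lt_one hρ0 hη2
  have hlim : Tendsto (fun m => C * (1 + (η / 2)⁻¹) * θ ^ m / (1 - θ)) atTop (𝓝 0) := by
    have := ((tendsto_pow_atTop_nhds_zero_of_lt_one hθ0 hθ1).const_mul
      (C * (1 + (η / 2)⁻¹))).div_const (1 - θ)
    simpa using this
  refine ⟨_, mem_nhdsWithin_of_mem_nhds (h1.and h2), ?_⟩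
  filter_upwards [hlim.eventually_lt_const hε] with m hm y hy
  rw [dist_comm]
  refine lt_of_le_of_lt (dist_picard_fixedPoint_le hS hH hη2 (fun j => (hy.2 j).le)
    (row_sum_le_sum hS) hρ0 m k) (lt_of_le_of_lt ?_ hm)
  have : 0 < 1 - θ := sub_pos.mpr hθ1
  gcongr
  exact hy.1.le

end FixedPointLimit

/-! ### Integration by parts for standard Gaussian vectors -/

section BoundedC1

variable {E F : Type*} [NormedAddCommGroup E] [NormedSpace ℝ E] [NormedAddCommGroup F]
  [NormedSpace ℝ F]

/-- Continuously differentiable complex functions which are bounded and have a bounded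
derivative. -/
structure BoundedC1 (f : E → ℂ) : Prop where
  contDiff : ContDiff ℝ 1 f
  bounded : ∃ C, ∀ x, ‖f x‖ ≤ C
  fderiv_bounded : ∃ C, ∀ x, ‖fderiv ℝ f x‖ ≤ C

namespace BoundedC1

lemma differentiable {f : E → ℂ} (hf : BoundedC1 f) : Differentiable ℝ f :=
  hf.contDiff.differentiable one_ne_zero

lemma continuous {f : E → ℂ} (hf : BoundedC1 f) : Continuous f := hf.contDiff.continuous

lemma continuous_fderiv {f : E → ℂ} (hf : BoundedC1 f) : Continuous (fderiv ℝ f) :=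
  hf.contDiff.continuous_fderiv one_ne_zero

lemma continuous_fderiv_apply {f : E → ℂ} (hf : BoundedC1 f) (v : E) :
    Continuous fun x => fderiv ℝ f x v := hf.continuous_fderiv.clm_apply continuous_const

lemma comp_affine {f : F → ℂ} (hf : BoundedC1 f) (L : E →L[ℝ] F) (b : F) :
    BoundedC1 fun x => f (L x + b) := by
  refine ⟨hf.contDiff.comp (L.contDiff.add contDiff_const), ?_, ?_⟩
  · obtain ⟨C, hC⟩ := hf.bounded
    exact ⟨C, fun x => hC _⟩
  · obtain ⟨C, hC⟩ := hf.fderiv_bounded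
    refine ⟨C * ‖L‖, fun x => ?_⟩
    have h : HasFDerivAt (fun x => f (L x + b)) ((fderiv ℝ f (L x + b)).comp L) x :=
      (hf.differentiable _).hasFDerivAt.comp x (L.hasFDerivAt.add_const b)
    rw [h.fderiv]
    exact (ContinuousLinearMap.opNorm_comp_le _ _).trans (by gcongr; exact hC _)

lemma const (c : ℂ) : BoundedC1 fun _ : E => c :=
  ⟨contDiff_const, ⟨‖c‖, fun _ => le_rfl⟩, ⟨0, fun x => by simp⟩⟩

lemma add {f g : E → ℂ} (hf : BoundedC1 f) (hg : BoundedC1 g) : BoundedC1 fun x => f x + g x := by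
  obtain ⟨C, hC⟩ := hf.bounded
  obtain ⟨D, hD⟩ := hg.bounded
  obtain ⟨C', hC'⟩ := hf.fderiv_bounded
  obtain ⟨D', hD'⟩ := hg.fderiv_bounded
  refine ⟨hf.contDiff.add hg.contDiff, ⟨C + D, fun x => ?_⟩, ⟨C' + D', fun x => ?_⟩⟩
  · exact (norm_add_le _ _).trans (add_le_add (hC x) (hD x))
  · rw [fderiv_fun_add (hf.differentiable x) (hg.differentiable x)]
    exact (norm_add_le _ _).trans (add_le_add (hC' x) (hD' x))

lemma mul {f g : E → ℂ} (hf : BoundedC1 f) (hg : BoundedC1 g) : BoundedC1 fun x => f x * g x := by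
  obtain ⟨C, hC⟩ := hf.bounded
  obtain ⟨D, hD⟩ := hg.bounded
  obtain ⟨C', hC'⟩ := hf.fderiv_bounded
  obtain ⟨D', hD'⟩ := hg.fderiv_bounded
  refine ⟨hf.contDiff.mul hg.contDiff, ⟨C * D, fun x => ?_⟩, ⟨C * D' + D * C', fun x => ?_⟩⟩
  · rw [norm_mul]
    exact mul_le_mul (hC x) (hD x) (norm_nonneg _) ((norm_nonneg _).trans (hC x))
  · rw [fderiv_fun_mul (hf.differentiable x) (hg.differentiable x)]
    refine (norm_add_le _ _).trans (add_le_add ?_ ?_)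
    · rw [norm_smul]
      exact mul_le_mul (hC x) (hD' x) (norm_nonneg _) ((norm_nonneg _).trans (hC x))
    · rw [norm_smul]
      exact mul_le_mul (hD x) (hC' x) (norm_nonneg _) ((norm_nonneg _).trans (hD x))

lemma pow {f : E → ℂ} (hf : BoundedC1 f) (k : ℕ) : BoundedC1 fun x => f x ^ k := by
  induction k with
  | zero => simpa using const 1
  | succ k ih => simpa [pow_succ] using ih.mul hf

lemma fderiv_conj {f : E → ℂ} (hf : BoundedC1 f) (x v : E) :
    fderiv ℝ (fun x => conj (f x)) x v = conj (fderiv ℝ f x v) := by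
  have h : HasFDerivAt (fun x => conj (f x))
      ((Complex.conjCLE : ℂ →L[ℝ] ℂ).comp (fderiv ℝ f x)) x :=
    (Complex.conjCLE : ℂ →L[ℝ] ℂ).hasFDerivAt.comp x (hf.differentiable x).hasFDerivAt
  rw [h.fderiv]
  rfl

lemma conjugate {f : E → ℂ} (hf : BoundedC1 f) : BoundedC1 fun x => conj (f x) := by
  obtain ⟨C, hC⟩ := hf.bounded
  obtain ⟨C', hC'⟩ := hf.fderiv_bounded
  refine ⟨(Complex.conjCLE : ℂ →L[ℝ] ℂ).contDiff.comp hf.contDiff, ⟨C, fun x => by simpa using hC x⟩,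
    ⟨C', fun x => ?_⟩⟩
  refine ContinuousLinearMap.opNorm_le_bound _ ((norm_nonneg _).trans (hC' x)) fun v => ?_
  rw [hf.fderiv_conj, RCLike.norm_conj]
  exact (fderiv ℝ f x).le_of_opNorm_le (hC' x) v

lemma sum {ι : Type*} (s : Finset ι) {f : ι → E → ℂ} (hf : ∀ i, BoundedC1 (f i)) :
    BoundedC1 fun x => ∑ i ∈ s, f i x := by
  classical
  induction s using Finset.induction_on with
  | empty => simpa using const 0
  | insert i s hi ih => simpa [Finset.sum_insert hi] using (hf i).add ih

variable [MeasurableSpace E] [BorelSpace E] {μ : Measure E}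
  [IsFiniteMeasure μ]

lemma integrable {f : E → ℂ} (hf : BoundedC1 f) : Integrable f μ := by
  obtain ⟨C, hC⟩ := hf.bounded
  exact Integrable.of_bound hf.continuous.aestronglyMeasurable C (Filter.Eventually.of_forall hC)

lemma integrable_fderiv_apply {f : E → ℂ} (hf : BoundedC1 f) (v : E) :
    Integrable (fun x => fderiv ℝ f x v) μ := by
  obtain ⟨C, hC⟩ := hf.fderiv_bounded
  exact Integrable.of_bound (hf.continuous_fderiv_apply v).aestronglyMeasurable (C * ‖v‖)
    (Filter.Eventually.of_forall fun x => (fderiv ℝ f x).le_of_opNorm_le (hC x) v)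

end BoundedC1

end BoundedC1

section GaussianIBP

lemma hasDerivAt_gaussianPDFReal_standard (x : ℝ) :
    HasDerivAt (gaussianPDFReal 0 1) (-x * gaussianPDFReal 0 1 x) x := by
  have h : gaussianPDFReal 0 1 = fun x : ℝ => (√(2 * Real.pi))⁻¹ * Real.exp (-x ^ 2 / 2) := by
    ext x; simp [gaussianPDFReal_def]
  rw [h]
  have h1 : HasDerivAt (fun x : ℝ => -x ^ 2 / 2) (-x) x := by
    exact (((hasDerivAt_pow 2 x).neg).div_const 2).congr_deriv (by ring)
  exact (h1.exp.const_mul (√(2 * Real.pi))⁻¹).congr_deriv (by ring)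

lemma integrable_gaussianReal_iff_integrable_smul {f : ℝ → ℂ} :
    Integrable f (gaussianReal 0 1) ↔ Integrable fun x => gaussianPDFReal 0 1 x • f x := by
  rw [gaussianReal, if_neg one_ne_zero, integrable_withDensity_iff_integrable_smul'
    (measurable_gaussianPDF 0 1) (Filter.Eventually.of_forall fun x => ENNReal.ofReal_lt_top)]
  simp [gaussianPDF, ENNReal.toReal_ofReal (gaussianPDFReal_nonneg 0 1 _)]

/-- **Stein's identity** in dimension one. -/
lemma integral_id_mul_gaussianReal {g : ℝ → ℂ} (hg : BoundedC1 g) :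
    ∫ x, (x : ℂ) * g x ∂(gaussianReal 0 1) = ∫ x, fderiv ℝ g x 1 ∂(gaussianReal 0 1) := by
  have hid : Integrable (fun x : ℝ => (x : ℂ)) (gaussianReal 0 1) :=
    Integrable.ofReal (IsGaussian.integrable_id (μ := gaussianReal 0 1))
  obtain ⟨C, hC⟩ := hg.bounded
  have h1 : Integrable (fun x : ℝ => (x : ℂ) * g x) (gaussianReal 0 1) :=
    hid.mul_bdd hg.continuous.aestronglyMeasurable (Filter.Eventually.of_forall hC)
  have h2 := hg.integrable_fderiv_apply (μ := gaussianReal 0 1) 1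
  have h3 := hg.integrable (μ := gaussianReal 0 1)
  rw [integrable_gaussianReal_iff_integrable_smul] at h1 h2 h3
  rw [integral_gaussianReal_eq_integral_smul one_ne_zero,
    integral_gaussianReal_eq_integral_smul one_ne_zero]
  have key := integral_mul_deriv_eq_deriv_mul_of_integrable (u := g)
    (u' := fun x => fderiv ℝ g x 1) (v := fun x => (gaussianPDFReal 0 1 x : ℂ))
    (v' := fun x => ((-x * gaussianPDFReal 0 1 x : ℝ) : ℂ))
    (fun x _ => (hg.differentiable x).hasFDerivAt.hasDerivAt)
    (fun x _ => (hasDerivAt_gaussianPDFReal_standard x).ofReal_comp)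
    (h1.neg.congr (Filter.Eventually.of_forall fun x => by simp; ring))
    (h2.congr (Filter.Eventually.of_forall fun x => by simp; ring))
    (h3.congr (Filter.Eventually.of_forall fun x => by simp; ring))
  have e1 : ∫ x : ℝ, gaussianPDFReal 0 1 x • ((x : ℂ) * g x) =
      -∫ x : ℝ, g x * ((-x * gaussianPDFReal 0 1 x : ℝ) : ℂ) := by
    rw [← integral_neg]
    congr 1; ext x; simp; ring
  rw [e1, key, neg_neg]
  congr 1; ext x; simp; ring

variable {ι : Type*} [Fintype ι]

/-- The standard Gaussian measure on `ι → ℝ`. -/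
noncomputable abbrev stdGaussianPi (ι : Type*) [Fintype ι] : Measure (ι → ℝ) :=
  Measure.pi fun _ : ι => gaussianReal 0 1

instance isGaussian_stdGaussianPi : IsGaussian (stdGaussianPi ι) := by
  have h : stdGaussianPi ι = (stdGaussian (EuclideanSpace ℝ ι)).map
      (EuclideanSpace.equiv ι ℝ : EuclideanSpace ℝ ι →L[ℝ] ι → ℝ) := by
    rw [← map_pi_eq_stdGaussian, Measure.map_map (by fun_prop) (by fun_prop)]
    exact Measure.map_id.symm
  rw [h]
  infer_instance

lemma integral_id_stdGaussianPi : ∫ x, id x ∂(stdGaussianPi ι) = 0 := by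
  ext i
  have h := (ContinuousLinearMap.proj (R := ℝ) (φ := fun _ : ι => ℝ) i).integral_comp_comm
    (IsGaussian.integrable_id (μ := stdGaussianPi ι))
  have h2 := (measurePreserving_eval (fun _ : ι => gaussianReal 0 1) i).map_eq
  have h3 : ∫ x : ι → ℝ, x i ∂(stdGaussianPi ι) = ∫ y, y ∂(gaussianReal 0 1) := by
    have h4 := integral_map (μ := stdGaussianPi ι) (measurable_pi_apply i).aemeasurable
      (f := fun y : ℝ => y) measurable_id.aestronglyMeasurable
    rw [← h4]
    exact congrArg (fun ν => ∫ y, y ∂ν) h2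
  rw [integral_id_gaussianReal] at h3
  simp only [id, ContinuousLinearMap.proj_apply] at h
  simp only [id, Pi.zero_apply]
  rw [← h, h3]

lemma integrable_coord (α : ι) : Integrable (fun x : ι → ℝ => (x α : ℂ)) (stdGaussianPi ι) :=
  ((ContinuousLinearMap.proj (R := ℝ) (φ := fun _ : ι => ℝ) α).integrable_comp
    (IsGaussian.integrable_id (μ := stdGaussianPi ι))).ofReal

lemma integrable_coord_mul {f : (ι → ℝ) → ℂ} (hf : BoundedC1 f) (α : ι) :
    Integrable (fun x => (x α : ℂ) * f x) (stdGaussianPi ι) := by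
  obtain ⟨C, hC⟩ := hf.bounded
  exact (integrable_coord α).mul_bdd hf.continuous.aestronglyMeasurable
    (Filter.Eventually.of_forall hC)

variable [DecidableEq ι]

lemma measurePreserving_update (α : ι) :
    MeasurePreserving (fun p : (ι → ℝ) × ℝ => Function.update p.1 α p.2)
      ((stdGaussianPi ι).prod (gaussianReal 0 1)) (stdGaussianPi ι) := by
  refine ⟨by fun_prop, (Measure.pi_eq fun s hs => ?_).symm⟩
  rw [Measure.map_apply (by fun_prop) (MeasurableSet.univ_pi hs)]
  have : (fun p : (ι → ℝ) × ℝ => Function.update p.1 α p.2) ⁻¹' Set.univ.pi s =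
      (Set.univ.pi (Function.update s α Set.univ)) ×ˢ s α := by
    ext p
    simp only [Set.mem_preimage, Set.mem_univ_pi, Set.mem_prod]
    constructor
    · refine fun h => ⟨fun i => ?_, by simpa using h α⟩
      by_cases hi : i = α
      · subst hi; simp
      · simpa [hi] using h i
    · rintro ⟨h1, h2⟩ i
      by_cases hi : i = α
      · subst hi; simpa using h2
      · simpa [hi] using h1 i
  rw [this, Measure.prod_prod, Measure.pi_pi, ← Finset.prod_erase_mul _ _ (Finset.mem_univ α),
    ← Finset.prod_erase_mul Finset.univ _ (Finset.mem_univ α)]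
  simp only [Function.update_self, measure_univ, mul_one]
  congr 1
  refine Finset.prod_congr rfl fun i hi => ?_
  rw [Function.update_of_ne (Finset.ne_of_mem_erase hi)]

/-- **Gaussian integration by parts.** -/
lemma integral_coord_mul {f : (ι → ℝ) → ℂ} (hf : BoundedC1 f) (α : ι) :
    ∫ x, (x α : ℂ) * f x ∂(stdGaussianPi ι) =
      ∫ x, fderiv ℝ f x (Pi.single α 1) ∂(stdGaussianPi ι) := by
  have hmp := measurePreserving_update α
  have hi1 := integrable_coord_mul hf α
  have hi2 := hf.integrable_fderiv_apply (μ := stdGaussianPi ι) (Pi.single α 1)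
  have e1 := integral_map hmp.aemeasurable (μ := (stdGaussianPi ι).prod (gaussianReal 0 1))
    (f := fun x : ι → ℝ => (x α : ℂ) * f x) (by rw [hmp.map_eq]; exact hi1.aestronglyMeasurable)
  have e2 := integral_map hmp.aemeasurable (μ := (stdGaussianPi ι).prod (gaussianReal 0 1))
    (f := fun x : ι → ℝ => fderiv ℝ f x (Pi.single α 1))
    (by rw [hmp.map_eq]; exact hi2.aestronglyMeasurable)
  rw [hmp.map_eq] at e1 e2
  rw [e1, e2]
  refine (integral_prod _ (hmp.integrable_comp_of_integrable hi1)).trans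
    (Eq.trans ?_ (integral_prod _ (hmp.integrable_comp_of_integrable hi2)).symm)
  congr 1
  ext x
  simp only [Function.comp_apply]
  -- in the coordinate `α` alone this is the one-dimensional identity
  have hup : ∀ t : ℝ, Function.update x α t =
      ContinuousLinearMap.smulRight (1 : ℝ →L[ℝ] ℝ) (Pi.single α (1 : ℝ) : ι → ℝ) t +
        Function.update x α 0 := by
    intro t
    ext i
    by_cases hi : i = α
    · subst hi; simp
    · simp [hi]
  have hg := hf.comp_affine
    (ContinuousLinearMap.smulRight (1 : ℝ →L[ℝ] ℝ) (Pi.single α (1 : ℝ) : ι → ℝ))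
    (Function.update x α 0)
  have key := integral_id_mul_gaussianReal hg
  have hd : ∀ t : ℝ, fderiv ℝ (fun t => f (ContinuousLinearMap.smulRight (1 : ℝ →L[ℝ] ℝ)
      (Pi.single α (1 : ℝ) : ι → ℝ) t + Function.update x α 0)) t 1 =
      fderiv ℝ f (Function.update x α t) (Pi.single α 1) := by
    intro t
    have h := (hf.differentiable _).hasFDerivAt.comp t
      ((ContinuousLinearMap.smulRight (1 : ℝ →L[ℝ] ℝ)
        (Pi.single α (1 : ℝ) : ι → ℝ)).hasFDerivAt.add_const (Function.update x α 0))
    have h' := h.fderiv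
    simp only [Function.comp_def] at h'
    rw [h', ← hup]
    simp
  rw [integral_congr_ae (Filter.Eventually.of_forall hd)] at key
  simp only [← hup] at key
  simpa using key

end GaussianIBP

/-! ### Gaussian covariance inequality -/

section Covariance

variable {ι : Type*} [Fintype ι] [DecidableEq ι]

/-- The Euclidean norm of the gradient of `f` at `x`. -/
noncomputable def gradNorm (f : (ι → ℝ) → ℂ) (x : ι → ℝ) : ℝ :=
  √(∑ α, ‖fderiv ℝ f x (Pi.single α 1)‖ ^ 2)

lemma gradNorm_nonneg (f : (ι → ℝ) → ℂ) (x : ι → ℝ) : 0 ≤ gradNorm f x := Real.sqrt_nonneg _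

lemma BoundedC1.continuous_gradNorm {f : (ι → ℝ) → ℂ} (hf : BoundedC1 f) :
    Continuous (gradNorm f) :=
  (continuous_finsetSum _ fun _ _ => (hf.continuous_fderiv_apply _).norm.pow 2).sqrt

lemma BoundedC1.exists_gradNorm_le {f : (ι → ℝ) → ℂ} (hf : BoundedC1 f) :
    ∃ C, ∀ x, gradNorm f x ≤ C := by
  obtain ⟨C, hC⟩ := hf.fderiv_bounded
  refine ⟨√(∑ α : ι, (C * ‖(Pi.single α 1 : ι → ℝ)‖) ^ 2), fun x => Real.sqrt_le_sqrt ?_⟩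
  exact Finset.sum_le_sum fun α _ =>
    pow_le_pow_left₀ (norm_nonneg _) ((fderiv ℝ f x).le_of_opNorm_le (hC x) _) 2

lemma BoundedC1.integrable_gradNorm {f : (ι → ℝ) → ℂ} (hf : BoundedC1 f) :
    Integrable (gradNorm f) (stdGaussianPi ι) := by
  obtain ⟨C, hC⟩ := hf.exists_gradNorm_le
  refine Integrable.of_bound hf.continuous_gradNorm.aestronglyMeasurable C
    (Filter.Eventually.of_forall fun x => ?_)
  rw [Real.norm_of_nonneg (gradNorm_nonneg f x)]
  exact hC x

lemma clm_apply_eq_sum (L : (ι → ℝ) →L[ℝ] ℂ) (v : ι → ℝ) :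
    L v = ∑ α, (v α : ℂ) * L (Pi.single α 1) := by
  conv_lhs => rw [pi_eq_sum_univ' v, map_sum]
  refine Finset.sum_congr rfl fun α _ => ?_
  rw [map_smul, Complex.real_smul]

/-- Integration by parts in the second variable of a pair of independent Gaussian vectors. -/
lemma integral_fderiv_rotation {f h : (ι → ℝ) → ℂ} (hf : BoundedC1 f) (hh : BoundedC1 h)
    (θ : ℝ) :
    ∫ q, f (Real.cos θ • q.1 - Real.sin θ • q.2) * fderiv ℝ h q.1 q.2
        ∂((stdGaussianPi ι).prod (stdGaussianPi ι)) =
      -(Real.sin θ : ℂ) * ∫ u, ∫ u', ∑ α, fderiv ℝ f (Real.cos θ • u - Real.sin θ • u')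
        (Pi.single α 1) * fderiv ℝ h u (Pi.single α 1) ∂(stdGaussianPi ι) ∂(stdGaussianPi ι) := by
  obtain ⟨C, hC⟩ := hf.bounded
  obtain ⟨D, hD⟩ := hh.fderiv_bounded
  have hint : Integrable (fun q : (ι → ℝ) × (ι → ℝ) =>
      f (Real.cos θ • q.1 - Real.sin θ • q.2) * fderiv ℝ h q.1 q.2)
      ((stdGaussianPi ι).prod (stdGaussianPi ι)) := by
    have h0 : Integrable (fun q : (ι → ℝ) × (ι → ℝ) => C * (D * ‖q.2‖))
        ((stdGaussianPi ι).prod (stdGaussianPi ι)) :=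
      (((IsGaussian.integrable_id (μ := stdGaussianPi ι)).norm.comp_snd _).const_mul D).const_mul C
    refine h0.mono' ?_ (Filter.Eventually.of_forall fun q => ?_)
    · refine Continuous.aestronglyMeasurable ((hf.continuous.comp (by fun_prop)).mul ?_)
      exact (hh.continuous_fderiv.comp continuous_fst).clm_apply continuous_snd
    · rw [norm_mul]
      exact mul_le_mul (hC _) ((fderiv ℝ h q.1).le_of_opNorm_le (hD _) _) (norm_nonneg _)
        ((norm_nonneg _).trans (hC q.1))
  rw [integral_prod _ hint, ← integral_const_mul]
  congr 1
  ext u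
  set L : (ι → ℝ) →L[ℝ] (ι → ℝ) := -Real.sin θ • ContinuousLinearMap.id ℝ (ι → ℝ) with hL
  have hfu := hf.comp_affine L (Real.cos θ • u)
  have harg : ∀ u' : ι → ℝ, L u' + Real.cos θ • u = Real.cos θ • u - Real.sin θ • u' := by
    intro u'; simp [hL]; abel
  have hder : ∀ u' α, fderiv ℝ (fun u' => f (L u' + Real.cos θ • u)) u' (Pi.single α 1) =
      -(Real.sin θ : ℂ) * fderiv ℝ f (Real.cos θ • u - Real.sin θ • u') (Pi.single α 1) := by
    intro u' α
    have h1 := (hf.differentiable _).hasFDerivAt.comp u'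
      (L.hasFDerivAt.add_const (Real.cos θ • u))
    have h2 := h1.fderiv
    simp only [Function.comp_def] at h2
    rw [h2, ← harg, ContinuousLinearMap.comp_apply, hL]
    simp
  calc ∫ u', f (Real.cos θ • u - Real.sin θ • u') * fderiv ℝ h u u' ∂(stdGaussianPi ι)
      = ∫ u', ∑ α, ((u' α : ℂ) * f (L u' + Real.cos θ • u)) * fderiv ℝ h u (Pi.single α 1)
          ∂(stdGaussianPi ι) := by
        congr 1; ext u'
        rw [clm_apply_eq_sum, Finset.mul_sum, harg]
        exact Finset.sum_congr rfl fun α _ => by ring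
    _ = ∑ α, ∫ u', (-(Real.sin θ : ℂ) * fderiv ℝ f (Real.cos θ • u - Real.sin θ • u')
          (Pi.single α 1)) * fderiv ℝ h u (Pi.single α 1) ∂(stdGaussianPi ι) := by
        rw [integral_finsetSum _ fun α _ => (integrable_coord_mul hfu α).mul_const _]
        refine Finset.sum_congr rfl fun α _ => ?_
        rw [integral_mul_const, integral_coord_mul hfu, ← integral_mul_const]
        simp only [hder]
    _ = _ := by
        rw [← integral_finsetSum, ← integral_const_mul]
        · congr 1; ext u'
          rw [Finset.mul_sum]
          exact Finset.sum_congr rfl fun α _ => by ring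
        · intro α _
          have := (hfu.integrable_fderiv_apply (μ := stdGaussianPi ι) (Pi.single α 1)).mul_const
            (fderiv ℝ h u (Pi.single α 1))
          simpa only [hder] using this

lemma norm_integral_fderiv_rotation_le {f h : (ι → ℝ) → ℂ} (hf : BoundedC1 f) (hh : BoundedC1 h)
    {L : ℝ} (hL : ∀ x, gradNorm f x ≤ L) (θ : ℝ) :
    ‖∫ q, f (Real.cos θ • q.1 - Real.sin θ • q.2) * fderiv ℝ h q.1 q.2
        ∂((stdGaussianPi ι).prod (stdGaussianPi ι))‖ ≤
      |Real.sin θ| * (L * ∫ u, gradNorm h u ∂(stdGaussianPi ι)) := by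
  rw [integral_fderiv_rotation hf hh θ, norm_mul, norm_neg, Complex.norm_real, Real.norm_eq_abs]
  refine mul_le_mul_of_nonneg_left ?_ (abs_nonneg _)
  rw [← integral_const_mul]
  refine norm_integral_le_of_norm_le (hh.integrable_gradNorm.const_mul L)
    (Filter.Eventually.of_forall fun u => ?_)
  refine (norm_integral_le_of_norm_le_const (C := L * gradNorm h u)
    (Filter.Eventually.of_forall fun u' => ?_)).trans (by simp)
  calc _ ≤ ∑ α, ‖fderiv ℝ f (Real.cos θ • u - Real.sin θ • u') (Pi.single α 1)‖ *
        ‖fderiv ℝ h u (Pi.single α 1)‖ :=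
        (norm_sum_le _ _).trans (Finset.sum_le_sum fun α _ => (norm_mul _ _).le)
    _ ≤ gradNorm f (Real.cos θ • u - Real.sin θ • u') * gradNorm h u :=
        Real.sum_mul_le_sqrt_mul_sqrt _ _ _
    _ ≤ L * gradNorm h u := mul_le_mul_of_nonneg_right (hL _) (gradNorm_nonneg _ _)

/-- **Gaussian covariance inequality**: the covariance of `f` and `h` is bounded by the supremum
of the gradient of `f` times the mean of the gradient of `h`. It follows by rotating one Gaussian
vector into an independent copy. -/
lemma norm_covariance_le {f h : (ι → ℝ) → ℂ} (hf : BoundedC1 f) (hh : BoundedC1 h)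
    {L : ℝ} (hL : ∀ x, gradNorm f x ≤ L) :
    ‖∫ x, f x * h x ∂(stdGaussianPi ι) -
        (∫ x, f x ∂(stdGaussianPi ι)) * ∫ x, h x ∂(stdGaussianPi ι)‖ ≤
      L * ∫ x, gradNorm h x ∂(stdGaussianPi ι) := by
  set μ := stdGaussianPi ι with hμ
  obtain ⟨C, hC⟩ := hf.bounded
  obtain ⟨D, hD⟩ := hh.fderiv_bounded
  set Ψ : ℝ → (ι → ℝ) × (ι → ℝ) → ℂ := fun θ p =>
    f p.1 * fderiv ℝ h (Real.cos θ • p.1 + Real.sin θ • p.2)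
      (-Real.sin θ • p.1 + Real.cos θ • p.2) with hΨ
  have hΨc : Continuous (Function.uncurry Ψ) := by
    refine Continuous.mul (hf.continuous.comp (by fun_prop)) ?_
    exact (hh.continuous_fderiv.comp (by fun_prop)).clm_apply (by fun_prop)
  have hΨb : ∀ θ p, ‖Ψ θ p‖ ≤ C * (D * (‖p.1‖ + ‖p.2‖)) := by
    intro θ p
    have hC0 := (norm_nonneg _).trans (hC p.1)
    have hD0 := (norm_nonneg _).trans (hD p.1)
    rw [hΨ, norm_mul]
    refine mul_le_mul (hC _) (((fderiv ℝ h _).le_of_opNorm_le (hD _) _).trans ?_) (norm_nonneg _)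
      hC0
    refine mul_le_mul_of_nonneg_left ((norm_add_le _ _).trans (add_le_add ?_ ?_)) hD0
    · rw [norm_smul, norm_neg]
      exact mul_le_of_le_one_left (norm_nonneg _) (Real.abs_sin_le_one θ)
    · rw [norm_smul]
      exact mul_le_of_le_one_left (norm_nonneg _) (Real.abs_cos_le_one θ)
  have hbint : Integrable (fun p : (ι → ℝ) × (ι → ℝ) => C * (D * (‖p.1‖ + ‖p.2‖))) (μ.prod μ) := by
    have h0 := (IsGaussian.integrable_id (μ := μ)).norm
    exact (((h0.comp_fst _).add (h0.comp_snd _)).const_mul D).const_mul C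
  -- the fundamental theorem of calculus along the rotation from `p.1` to `p.2`
  have hftc : ∀ p : (ι → ℝ) × (ι → ℝ),
      f p.1 * h p.2 - f p.1 * h p.1 = ∫ θ in (0 : ℝ)..(Real.pi / 2), Ψ θ p := by
    intro p
    have hd : ∀ θ : ℝ, HasDerivAt (fun θ => f p.1 * h (Real.cos θ • p.1 + Real.sin θ • p.2))
        (Ψ θ p) θ := by
      intro θ
      have h1 : HasDerivAt (fun θ : ℝ => Real.cos θ • p.1 + Real.sin θ • p.2)
          (-Real.sin θ • p.1 + Real.cos θ • p.2) θ :=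
        ((Real.hasDerivAt_cos θ).smul_const p.1).add ((Real.hasDerivAt_sin θ).smul_const p.2)
      exact ((hh.differentiable _).hasFDerivAt.comp_hasDerivAt θ h1).const_mul (f p.1)
    rw [intervalIntegral.integral_eq_sub_of_hasDerivAt (fun θ _ => hd θ)]
    · simp
    · exact (hΨc.comp (by fun_prop : Continuous fun θ : ℝ => (θ, p))).intervalIntegrable _ _
  have hfi := hf.integrable (μ := μ)
  have hhi := hh.integrable (μ := μ)
  have hfh := (hf.mul hh).integrable (μ := μ)
  have e1 : ∫ p, (f p.1 * h p.2 - f p.1 * h p.1) ∂(μ.prod μ) =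
      (∫ x, f x ∂μ) * (∫ x, h x ∂μ) - ∫ x, f x * h x ∂μ := by
    rw [integral_sub (hfi.mul_prod hhi) (hfh.comp_fst μ), integral_prod_mul]
    congr 1
    rw [integral_fun_fst (fun x => f x * h x)]
    simp
  have hpi : (0 : ℝ) ≤ Real.pi / 2 := by positivity
  have e2 : ∫ p, (f p.1 * h p.2 - f p.1 * h p.1) ∂(μ.prod μ) =
      ∫ θ in (0 : ℝ)..(Real.pi / 2), ∫ p, Ψ θ p ∂(μ.prod μ) := by
    simp only [hftc, intervalIntegral.integral_of_le hpi]
    rw [integral_integral_swap]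
    have h0 : Integrable (fun q : ((ι → ℝ) × (ι → ℝ)) × ℝ => C * (D * (‖q.1.1‖ + ‖q.1.2‖)))
        ((μ.prod μ).prod (volume.restrict (Set.Ioc 0 (Real.pi / 2)))) := hbint.comp_fst _
    refine h0.mono' ?_ (Filter.Eventually.of_forall fun q => hΨb _ _)
    exact (hΨc.comp (by fun_prop : Continuous fun q : ((ι → ℝ) × (ι → ℝ)) × ℝ =>
      (q.2, q.1))).aestronglyMeasurable
  have e3 : ∀ θ : ℝ, ∫ p, Ψ θ p ∂(μ.prod μ) =
      ∫ q, f (Real.cos θ • q.1 - Real.sin θ • q.2) * fderiv ℝ h q.1 q.2 ∂(μ.prod μ) := by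
    intro θ
    have hrot := IsGaussian.map_rotation_eq_self (μ := μ) integral_id_stdGaussianPi θ
    conv_rhs => rw [← hrot]
    rw [integral_map (ContinuousLinearMap.measurable _).aemeasurable]
    · congr 1
      ext p
      have : Real.cos θ • (ContinuousLinearMap.rotation θ p).1 -
          Real.sin θ • (ContinuousLinearMap.rotation θ p).2 = p.1 := by
        rw [ContinuousLinearMap.rotation_apply]
        ext i
        simp only [Pi.sub_apply, Pi.smul_apply, Pi.add_apply, smul_eq_mul]
        linear_combination p.1 i * Real.sin_sq_add_cos_sq θ
      rw [this, ContinuousLinearMap.rotation_apply]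
    · refine Continuous.aestronglyMeasurable ((hf.continuous.comp (by fun_prop)).mul ?_)
      exact (hh.continuous_fderiv.comp continuous_fst).clm_apply continuous_snd
  rw [← norm_neg, neg_sub, ← e1, e2]
  refine (intervalIntegral.norm_integral_le_of_norm_le hpi
    (g := fun θ => Real.sin θ * (L * ∫ x, gradNorm h x ∂μ)) ?_ ?_).trans (le_of_eq ?_)
  · refine Filter.Eventually.of_forall fun θ hθ => ?_
    rw [e3]
    refine (norm_integral_fderiv_rotation_le hf hh hL θ).trans (le_of_eq ?_)
    rw [abs_of_nonneg (Real.sin_nonneg_of_nonneg_of_le_pi hθ.1.le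
      (hθ.2.trans (by linarith [Real.pi_pos])))]
  · exact (Continuous.intervalIntegrable (by fun_prop) _ _)
  · rw [intervalIntegral.integral_mul_const, integral_sin]
    simp

end Covariance

/-! ### Moments and concentration of complex functions of a Gaussian vector -/

section Concentration

variable {ι : Type*} [Fintype ι]

/-- The function `f` minus its mean under the standard Gaussian measure. -/
noncomputable def centered (f : (ι → ℝ) → ℂ) (x : ι → ℝ) : ℂ :=
  f x - ∫ y, f y ∂(stdGaussianPi ι)

lemma BoundedC1.centered {f : (ι → ℝ) → ℂ} (hf : BoundedC1 f) :
    BoundedC1 (centered f) := by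
  simpa [DeformedGUE.centered, sub_eq_add_neg] using! hf.add (const (-∫ y, f y ∂(stdGaussianPi ι)))

lemma fderiv_centered (f : (ι → ℝ) → ℂ) : fderiv ℝ (centered f) = fderiv ℝ f := by
  ext1 x
  exact fderiv_sub_const _

lemma integral_centered {f : (ι → ℝ) → ℂ} (hf : BoundedC1 f) :
    ∫ x, centered f x ∂(stdGaussianPi ι) = 0 := by
  simp only [centered]
  rw [integral_sub hf.integrable (integrable_const _)]
  simp

lemma integrable_norm_centered_pow {f : (ι → ℝ) → ℂ} (hf : BoundedC1 f) (k : ℕ) :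
    Integrable (fun x => ‖centered f x‖ ^ k) (stdGaussianPi ι) := by
  simpa using ((hf.centered.pow k).integrable (μ := stdGaussianPi ι)).norm

variable [DecidableEq ι]

lemma gradNorm_pow_mul_conj_pow_le {g : (ι → ℝ) → ℂ} (hg : BoundedC1 g) (k : ℕ) (x : ι → ℝ) :
    gradNorm (fun x => g x ^ (k + 1) * conj (g x) ^ k) x ≤
      (2 * k + 1) * ‖g x‖ ^ (2 * k) * gradNorm g x := by
  have hder : ∀ v, fderiv ℝ (fun x => g x ^ (k + 1) * conj (g x) ^ k) x v =
      g x ^ (k + 1) * (k * conj (g x) ^ (k - 1) * conj (fderiv ℝ g x v)) +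
        conj (g x) ^ k * ((k + 1) * g x ^ k * fderiv ℝ g x v) := by
    intro v
    rw [fderiv_fun_mul ((hg.pow (k + 1)).differentiable x) ((hg.conjugate.pow k).differentiable x),
      fderiv_fun_pow _ (hg.differentiable x), fderiv_fun_pow _ (hg.conjugate.differentiable x)]
    simp [hg.fderiv_conj]
  have hpow : ‖g x‖ ^ (k + 1) * (k * ‖g x‖ ^ (k - 1)) = k * ‖g x‖ ^ (2 * k) := by
    rcases k with _ | k
    · simp
    · rw [Nat.add_sub_cancel]; ring
  unfold gradNorm
  refine Real.sqrt_le_iff.mpr ⟨by positivity, ?_⟩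
  rw [mul_pow, Real.sq_sqrt (by positivity), Finset.mul_sum]
  refine Finset.sum_le_sum fun α _ => ?_
  rw [← mul_pow]
  refine pow_le_pow_left₀ (norm_nonneg _) ?_ 2
  rw [hder]
  refine (norm_add_le _ _).trans (le_of_eq ?_)
  simp only [norm_mul, norm_pow, RCLike.norm_conj, Complex.norm_natCast]
  have : ‖(k : ℂ) + 1‖ = k + 1 := by exact_mod_cast Complex.norm_natCast (k + 1)
  rw [this, ← mul_assoc, hpow]
  ring

lemma integral_norm_centered_pow_succ_le {f : (ι → ℝ) → ℂ} (hf : BoundedC1 f) {L : ℝ}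
    (hL : ∀ x, gradNorm f x ≤ L) (k : ℕ) :
    ∫ x, ‖centered f x‖ ^ (2 * (k + 1)) ∂(stdGaussianPi ι) ≤
      (2 * k + 1) * L ^ 2 * ∫ x, ‖centered f x‖ ^ (2 * k) ∂(stdGaussianPi ι) := by
  have hc := hf.centered
  have hL0 : 0 ≤ L := (gradNorm_nonneg f 0).trans (hL 0)
  have hgc : ∀ x, gradNorm (centered f) x = gradNorm f x := fun x => by
    unfold gradNorm; rw [fderiv_centered]
  have hg : ∀ x, gradNorm (fun x => conj (centered f x)) x ≤ L := fun x => by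
    refine le_trans (le_of_eq ?_) (hL x)
    rw [← hgc]
    unfold gradNorm
    simp [hc.fderiv_conj]
  have key := norm_covariance_le hc.conjugate ((hc.pow (k + 1)).mul (hc.conjugate.pow k)) hg
  have h0 : ∫ x, conj (centered f x) ∂(stdGaussianPi ι) = 0 := by
    rw [integral_conj, integral_centered hf, map_zero]
  have h1 : ∀ x, conj (centered f x) * (centered f x ^ (k + 1) * conj (centered f x) ^ k) =
      ((‖centered f x‖ ^ (2 * (k + 1)) : ℝ) : ℂ) := by
    intro x
    rw [pow_mul, Complex.ofReal_pow, Complex.ofReal_pow, ← Complex.mul_conj', mul_pow]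
    ring
  simp only [h1] at key
  rw [h0, zero_mul, sub_zero, integral_complex_ofReal, Complex.norm_real, Real.norm_eq_abs] at key
  refine (le_abs_self _).trans (key.trans ?_)
  have h2 : ∫ x, gradNorm (fun x => centered f x ^ (k + 1) * conj (centered f x) ^ k) x
      ∂(stdGaussianPi ι) ≤ ∫ x, (2 * k + 1) * L * ‖centered f x‖ ^ (2 * k) ∂(stdGaussianPi ι) := by
    refine integral_mono ((hc.pow (k + 1)).mul (hc.conjugate.pow k)).integrable_gradNorm
      ((integrable_norm_centered_pow hf _).const_mul _) fun x => ?_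
    refine (gradNorm_pow_mul_conj_pow_le hc k x).trans ?_
    rw [hgc]
    have := hL x
    calc _ ≤ (2 * k + 1) * ‖centered f x‖ ^ (2 * k) * L := by gcongr
      _ = _ := by ring
  refine (mul_le_mul_of_nonneg_left h2 hL0).trans (le_of_eq ?_)
  rw [integral_const_mul]
  ring

/-- The even moments of a centered function with gradient at most `L` are at most those of a real
Gaussian variable of variance `L ^ 2`. -/
lemma integral_norm_centered_pow_le {f : (ι → ℝ) → ℂ} (hf : BoundedC1 f) {L : ℝ}
    (hL : ∀ x, gradNorm f x ≤ L) (k : ℕ) :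
    ∫ x, ‖centered f x‖ ^ (2 * k) ∂(stdGaussianPi ι) ≤
      (2 * k).factorial * ((L ^ 2 / 2) ^ k / k.factorial) := by
  induction k with
  | zero => simp
  | succ k ih =>
    refine (integral_norm_centered_pow_succ_le hf hL k).trans
      ((mul_le_mul_of_nonneg_left ih (by positivity)).trans (le_of_eq ?_))
    have h1 : (2 * (k + 1)).factorial = (2 * k + 2) * ((2 * k + 1) * (2 * k).factorial) := by
      rw [mul_add, mul_one, Nat.factorial_succ, Nat.factorial_succ]
    rw [h1, Nat.factorial_succ]
    push_cast
    have hk : (k.factorial : ℝ) ≠ 0 := by positivity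
    field_simp
    ring

/-- The Gaussian Poincaré inequality, for a bounded gradient. -/
lemma integral_norm_centered_sq_le {f : (ι → ℝ) → ℂ} (hf : BoundedC1 f) {L : ℝ}
    (hL : ∀ x, gradNorm f x ≤ L) :
    ∫ x, ‖centered f x‖ ^ 2 ∂(stdGaussianPi ι) ≤ L ^ 2 := by
  have := integral_norm_centered_pow_le hf hL 1
  simpa [mul_div_cancel₀] using this

lemma integral_cosh_norm_centered_le {f : (ι → ℝ) → ℂ} (hf : BoundedC1 f) {L : ℝ}
    (hL : ∀ x, gradNorm f x ≤ L) (s : ℝ) :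
    ∫ x, Real.cosh (s * ‖centered f x‖) ∂(stdGaussianPi ι) ≤ Real.exp (s ^ 2 * L ^ 2 / 2) := by
  set F : ℕ → (ι → ℝ) → ℝ := fun k x => (s * ‖centered f x‖) ^ (2 * k) / (2 * k).factorial with hF
  have hFi : ∀ k, Integrable (F k) (stdGaussianPi ι) := fun k => by
    simp only [hF, mul_pow]
    exact ((integrable_norm_centered_pow hf _).const_mul _).div_const _
  have hF0 : ∀ k x, 0 ≤ F k x := fun k x => by
    simp only [hF, pow_mul]; positivity
  have hb : ∀ k, ∫ x, F k x ∂(stdGaussianPi ι) ≤ (s ^ 2 * L ^ 2 / 2) ^ k / k.factorial := fun k => by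
    simp only [hF, mul_pow]
    rw [integral_div, integral_const_mul, div_le_iff₀ (by positivity)]
    have h1 : 0 ≤ s ^ (2 * k) := by rw [pow_mul]; positivity
    refine (mul_le_mul_of_nonneg_left (integral_norm_centered_pow_le hf hL k) h1).trans
      (le_of_eq ?_)
    rw [mul_div_assoc (s ^ 2), mul_pow, ← pow_mul]
    ring
  have hexp : HasSum (fun k : ℕ => (s ^ 2 * L ^ 2 / 2) ^ k / k.factorial)
      (Real.exp (s ^ 2 * L ^ 2 / 2)) := by
    rw [Real.exp_eq_exp_ℝ]; exact NormedSpace.expSeries_div_hasSum_exp _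
  have hsum : Summable fun k => ∫ x, ‖F k x‖ ∂(stdGaussianPi ι) := by
    refine Summable.of_nonneg_of_le (fun k => integral_nonneg fun x => norm_nonneg _)
      (fun k => ?_) hexp.summable
    simp only [Real.norm_of_nonneg (hF0 k _)]
    exact hb k
  have hs := hasSum_integral_of_summable_integral_norm hFi hsum
  have hc : ∀ x, ∑' k, F k x = Real.cosh (s * ‖centered f x‖) := fun x =>
    (Real.hasSum_cosh _).tsum_eq
  simp only [hc] at hs
  exact hasSum_le hb hs hexp

/-- **Gaussian concentration** for complex functions: the deviation in absolute value satisfies the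
same bound as for a real function whose gradient has norm at most `L`. -/
lemma measureReal_le_norm_centered_le {f : (ι → ℝ) → ℂ} (hf : BoundedC1 f) {L : ℝ} (hL0 : 0 < L)
    (hL : ∀ x, gradNorm f x ≤ L) {t : ℝ} (ht : 0 ≤ t) :
    (stdGaussianPi ι).real {x | t ≤ ‖centered f x‖} ≤ 2 * Real.exp (-(t ^ 2 / (2 * L ^ 2))) := by
  set s := t / L ^ 2 with hs
  have hs0 : 0 ≤ s := by positivity
  have hint : Integrable (fun x => Real.cosh (s * ‖centered f x‖)) (stdGaussianPi ι) := by
    obtain ⟨C, hC⟩ := hf.centered.bounded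
    refine Integrable.of_bound (Real.continuous_cosh.comp
      (hf.centered.continuous.norm.const_smul s)).aestronglyMeasurable (Real.cosh (s * C))
      (Filter.Eventually.of_forall fun x => ?_)
    rw [Real.norm_of_nonneg (Real.cosh_pos _).le, Real.cosh_le_cosh,
      abs_of_nonneg (by positivity),
      abs_of_nonneg (mul_nonneg hs0 ((norm_nonneg _).trans (hC x)))]
    exact mul_le_mul_of_nonneg_left (hC x) hs0
  have hmarkov := mul_meas_ge_le_integral_of_nonneg
    (Filter.Eventually.of_forall fun x => (Real.cosh_pos (s * ‖centered f x‖)).le) hint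
    (Real.cosh (s * t))
  have hsub : (stdGaussianPi ι).real {x | t ≤ ‖centered f x‖} ≤
      (stdGaussianPi ι).real {x | Real.cosh (s * t) ≤ Real.cosh (s * ‖centered f x‖)} := by
    refine measureReal_mono fun x hx => ?_
    simp only [Set.mem_ofPred_eq] at hx ⊢
    rw [Real.cosh_le_cosh, abs_of_nonneg (by positivity), abs_of_nonneg (by positivity)]
    exact mul_le_mul_of_nonneg_left hx hs0
  have hcosh : Real.exp (s * t) / 2 ≤ Real.cosh (s * t) := by
    rw [Real.cosh_eq]
    have := Real.exp_pos (-(s * t))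
    linarith
  have h1 : Real.exp (s * t) / 2 * (stdGaussianPi ι).real {x | t ≤ ‖centered f x‖} ≤
      Real.exp (s ^ 2 * L ^ 2 / 2) :=
    (mul_le_mul hcosh hsub measureReal_nonneg (Real.cosh_pos _).le).trans
      (hmarkov.trans (integral_cosh_norm_centered_le hf hL s))
  have h2 : -(t ^ 2 / (2 * L ^ 2)) = s ^ 2 * L ^ 2 / 2 - s * t := by
    rw [hs]; field_simp; ring
  rw [h2, Real.exp_sub]
  have h3 := Real.exp_pos (s * t)
  rw [mul_div_assoc', le_div_iff₀ h3]
  linarith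

end Concentration

/-! ### Resolvents of Gaussian Hermitian matrices -/

section GaussianMatrix

variable {n ι : Type*} [Fintype ι]

/-- The matrix `∑ α, g α • A α`, which is Gaussian when `g` is a standard Gaussian vector. -/
noncomputable def gaussianMatrix (A : ι → Matrix n n ℂ) (g : ι → ℝ) : Matrix n n ℂ :=
  ∑ α, g α • A α

lemma gaussianMatrix_apply (A : ι → Matrix n n ℂ) (g : ι → ℝ) (i j : n) :
    gaussianMatrix A g i j = ∑ α, (g α : ℂ) * A α i j := by
  simp [gaussianMatrix, Matrix.sum_apply]

lemma isHermitian_add_gaussianMatrix {A : ι → Matrix n n ℂ} (hA : ∀ α, (A α).IsHermitian)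
    {Y : Matrix n n ℂ} (hY : Y.IsHermitian) (g : ι → ℝ) :
    (Y + gaussianMatrix A g).IsHermitian := by
  refine hY.add ?_
  ext i j
  rw [Matrix.conjTranspose_apply, gaussianMatrix_apply, gaussianMatrix_apply, star_sum]
  refine Finset.sum_congr rfl fun α _ => ?_
  rw [star_mul', (hA α).apply]
  simp

lemma gaussianMatrix_single [DecidableEq ι] (A : ι → Matrix n n ℂ) (α : ι) :
    gaussianMatrix A (Pi.single α 1) = A α := by
  ext i j
  rw [gaussianMatrix_apply, Finset.sum_eq_single α]
  · simp
  · intro β _ hβ; simp [hβ]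
  · simp

variable [Fintype n] [DecidableEq n]

/-- The Hermitian matrices `A α` are the coefficients of a Gaussian matrix whose entries `X a b` and
`X c d` have pseudo-covariance `S a b` if `(c, d) = (b, a)` and `0` otherwise. -/
structure HasProfile (A : ι → Matrix n n ℂ) (S : Matrix n n ℝ) : Prop where
  hermitian : ∀ α, (A α).IsHermitian
  covariance : ∀ a b c d, ∑ α, A α a b * A α c d = if a = d ∧ b = c then (S a b : ℂ) else 0

lemma contDiff_gaussianMatrix (A : ι → Matrix n n ℂ) :
    ContDiff ℝ 1 fun g => gaussianMatrix A g :=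
  ContDiff.sum fun α _ => (contDiff_apply ℝ ℝ α).smul contDiff_const

lemma hasFDerivAt_gaussianMatrix (A : ι → Matrix n n ℂ) (g : ι → ℝ) :
    HasFDerivAt (gaussianMatrix A)
      (∑ α, (ContinuousLinearMap.proj (R := ℝ) (φ := fun _ : ι => ℝ) α).smulRight (A α)) g :=
  HasFDerivAt.fun_sum fun α _ =>
    (ContinuousLinearMap.proj (R := ℝ) (φ := fun _ : ι => ℝ) α).hasFDerivAt.smul_const (A α)

section Resolvent

variable {A : ι → Matrix n n ℂ} {Y : Matrix n n ℂ} {a : n → ℂ}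

/-- The random resolvent `(diag(a) - Y - ∑ α, g α • A α)⁻¹`. -/
noncomputable def gaussianResolvent (A : ι → Matrix n n ℂ) (Y : Matrix n n ℂ) (a : n → ℂ)
    (g : ι → ℝ) : Matrix n n ℂ := resolvent (Y + gaussianMatrix A g) a

lemma contDiff_gaussianResolvent (hA : ∀ α, (A α).IsHermitian) (hY : Y.IsHermitian)
    (ha : ∀ k, 0 < (a k).im) (i j : n) :
    ContDiff ℝ 1 fun g => gaussianResolvent A Y a g i j := by
  rw [contDiff_iff_contDiffAt]
  intro g
  obtain ⟨u, hu⟩ := (Matrix.isUnit_iff_isUnit_det _).mpr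
    (isUnit_det_diagonal_sub (isHermitian_add_gaussianMatrix hA hY g) ha)
  have h1 : ContDiffAt ℝ 1 (fun g => Matrix.diagonal a - (Y + gaussianMatrix A g)) g :=
    (contDiff_const.sub (contDiff_const.add (contDiff_gaussianMatrix A))).contDiffAt
  have h2 : ContDiffAt ℝ 1 (Ring.inverse : Matrix n n ℂ → Matrix n n ℂ)
      (Matrix.diagonal a - (Y + gaussianMatrix A g)) := by
    rw [← hu]; exact contDiffAt_ringInverse ℝ u
  have h4 := (Matrix.entryLinearMap ℝ ℂ i j).toContinuousLinearMap.contDiff.contDiffAt.comp g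
    (h2.comp g h1)
  refine h4.congr_of_eventuallyEq (Filter.Eventually.of_forall fun y => ?_)
  simp [gaussianResolvent, resolvent, Matrix.nonsing_inv_eq_ringInverse]

lemma fderiv_gaussianResolvent (hA : ∀ α, (A α).IsHermitian) (hY : Y.IsHermitian)
    (ha : ∀ k, 0 < (a k).im) (i j : n) (g v : ι → ℝ) :
    fderiv ℝ (fun g => gaussianResolvent A Y a g i j) g v =
      (gaussianResolvent A Y a g * gaussianMatrix A v * gaussianResolvent A Y a g) i j := by
  obtain ⟨u, hu⟩ := (Matrix.isUnit_iff_isUnit_det _).mpr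
    (isUnit_det_diagonal_sub (isHermitian_add_gaussianMatrix hA hY g) ha)
  have h1 := ((hasFDerivAt_gaussianMatrix A g).const_add Y).const_sub (Matrix.diagonal a)
  have h2 : HasFDerivAt (Ring.inverse : Matrix n n ℂ → Matrix n n ℂ)
      (-ContinuousLinearMap.mulLeftRight ℝ (Matrix n n ℂ) ↑u⁻¹ ↑u⁻¹)
      (Matrix.diagonal a - (Y + gaussianMatrix A g)) := by
    rw [← hu]; exact hasFDerivAt_ringInverse (𝕜 := ℝ) u
  have h4 := (Matrix.entryLinearMap ℝ ℂ i j).toContinuousLinearMap.hasFDerivAt.comp g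
    (h2.comp g h1)
  have h5 : (fun g => gaussianResolvent A Y a g i j) =
      (Matrix.entryLinearMap ℝ ℂ i j).toContinuousLinearMap ∘ (Ring.inverse ∘ fun g =>
        Matrix.diagonal a - (Y + gaussianMatrix A g)) := by
    ext y
    simp [gaussianResolvent, resolvent, Matrix.nonsing_inv_eq_ringInverse]
  have h6 : (↑u⁻¹ : Matrix n n ℂ) = gaussianResolvent A Y a g := by
    rw [gaussianResolvent, resolvent, Matrix.nonsing_inv_eq_ringInverse, ← hu, Ring.inverse_unit]
  rw [h5, h4.fderiv]
  have h7 : (∑ α, (ContinuousLinearMap.proj (R := ℝ) (φ := fun _ : ι => ℝ) α).smulRight (A α)) v =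
      gaussianMatrix A v := by
    simp [gaussianMatrix]
  simp only [ContinuousLinearMap.comp_apply, _root_.neg_apply, h7,
    ContinuousLinearMap.mulLeftRight_apply, h6]
  simp

variable {η : ℝ}

lemma boundedC1_gaussianResolvent (hA : ∀ α, (A α).IsHermitian) (hY : Y.IsHermitian)
    (hη : 0 < η) (ha : ∀ k, η ≤ (a k).im) (i j : n) :
    BoundedC1 fun g => gaussianResolvent A Y a g i j := by
  have hap : ∀ k, 0 < (a k).im := fun k => hη.trans_le (ha k)
  have hT : ∀ g i j, ‖gaussianResolvent A Y a g i j‖ ≤ η⁻¹ := fun g i j =>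
    norm_resolvent_apply_le (isHermitian_add_gaussianMatrix hA hY g) hη ha i j
  refine ⟨contDiff_gaussianResolvent hA hY hap i j, ⟨η⁻¹, fun g => hT g i j⟩,
    ⟨∑ k, ∑ l, η⁻¹ * (∑ α, ‖A α l k‖) * η⁻¹, fun g => ?_⟩⟩
  refine ContinuousLinearMap.opNorm_le_bound _ (by positivity) fun v => ?_
  rw [fderiv_gaussianResolvent hA hY hap, Matrix.mul_apply, Finset.sum_mul]
  refine (norm_sum_le _ _).trans (Finset.sum_le_sum fun k _ => ?_)
  rw [Matrix.mul_apply, Finset.sum_mul, Finset.sum_mul]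
  refine (norm_sum_le _ _).trans (Finset.sum_le_sum fun l _ => ?_)
  have hX : ‖gaussianMatrix A v l k‖ ≤ (∑ α, ‖A α l k‖) * ‖v‖ := by
    rw [gaussianMatrix_apply, Finset.sum_mul]
    refine (norm_sum_le _ _).trans (Finset.sum_le_sum fun α _ => ?_)
    rw [norm_mul, Complex.norm_real, mul_comm]
    exact mul_le_mul_of_nonneg_left (norm_le_pi_norm v α) (norm_nonneg _)
  rw [norm_mul, norm_mul]
  calc _ ≤ η⁻¹ * ((∑ α, ‖A α l k‖) * ‖v‖) * η⁻¹ := by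
        gcongr
        · exact hT g i l
        · exact hT g k j
    _ = _ := by ring

lemma HasProfile.sum_norm_sq {S : Matrix n n ℝ} (h : HasProfile A S) (M : Matrix n n ℂ) :
    ∑ α, ‖∑ k, ∑ l, A α k l * M l k‖ ^ 2 = ∑ k, ∑ l, S k l * ‖M l k‖ ^ 2 := by
  have hconj : ∀ α, conj (∑ k, ∑ l, A α k l * M l k) = ∑ c, ∑ d, A α d c * conj (M d c) := by
    intro α
    rw [map_sum]
    refine Finset.sum_congr rfl fun c _ => ?_
    rw [map_sum]
    refine Finset.sum_congr rfl fun d _ => ?_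
    rw [map_mul]
    congr 1
    exact (h.hermitian α).apply d c
  have : ((∑ α, ‖∑ k, ∑ l, A α k l * M l k‖ ^ 2 : ℝ) : ℂ) =
      ((∑ k, ∑ l, S k l * ‖M l k‖ ^ 2 : ℝ) : ℂ) := by
    push_cast
    simp only [← Complex.mul_conj', hconj]
    calc ∑ α, (∑ k, ∑ l, A α k l * M l k) * ∑ c, ∑ d, A α d c * conj (M d c)
        = ∑ k, ∑ l, ∑ c, ∑ d, (∑ α, A α c d * A α l k) * (M d c * conj (M l k)) := by
          simp only [Finset.sum_mul, Finset.mul_sum]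
          rw [Finset.sum_comm]
          refine Finset.sum_congr rfl fun k _ => ?_
          rw [Finset.sum_comm]
          refine Finset.sum_congr rfl fun l _ => ?_
          rw [Finset.sum_comm]
          refine Finset.sum_congr rfl fun c _ => ?_
          rw [Finset.sum_comm]
          refine Finset.sum_congr rfl fun d _ => ?_
          exact Finset.sum_congr rfl fun α _ => by ring
      _ = _ := by
          refine Finset.sum_congr rfl fun k _ => Finset.sum_congr rfl fun l _ => ?_
          simp only [h.covariance, ite_and, ite_mul, zero_mul]
          simp
  exact_mod_cast this

variable [DecidableEq ι]

/-- The gradient of a linear statistic `∑ j, D j * T j j` of the resolvent `T`. -/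
lemma gradNorm_sum_gaussianResolvent_le {S : Matrix n n ℝ} (h : HasProfile A S)
    (hY : Y.IsHermitian) (hη : 0 < η) (ha : ∀ k, η ≤ (a k).im) {σ : ℝ} (hσ : 0 ≤ σ)
    (hS : ∀ i j, S i j ≤ σ) (D : n → ℝ) (g : ι → ℝ) :
    gradNorm (fun g => ∑ j, (D j : ℂ) * gaussianResolvent A Y a g j j) g ≤
      √σ * (η⁻¹) ^ 2 * √(∑ j, D j ^ 2) := by
  have hap : ∀ k, 0 < (a k).im := fun k => hη.trans_le (ha k)
  set T := gaussianResolvent A Y a g with hT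
  have hH := isHermitian_add_gaussianMatrix h.hermitian hY g
  set M : Matrix n n ℂ := fun l k => ∑ j, T l j * ((D j : ℂ) * T j k) with hM
  have hder : ∀ α, fderiv ℝ (fun g => ∑ j, (D j : ℂ) * gaussianResolvent A Y a g j j) g
      (Pi.single α 1) = ∑ k, ∑ l, A α k l * M l k := by
    intro α
    have h1 : HasFDerivAt (fun g => ∑ j, (D j : ℂ) * gaussianResolvent A Y a g j j) _ g :=
      HasFDerivAt.fun_sum (u := Finset.univ) fun j _ =>
        (((boundedC1_gaussianResolvent h.hermitian hY hη ha j j).differentiable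
          g).hasFDerivAt.const_mul (D j : ℂ))
    rw [h1.fderiv]
    simp only [_root_.sum_apply, _root_.smul_apply,
      fderiv_gaussianResolvent h.hermitian hY hap, gaussianMatrix_single, smul_eq_mul, ← hT,
      Matrix.mul_apply, hM, Finset.mul_sum, Finset.sum_mul]
    calc ∑ j, ∑ l, ∑ k, (D j : ℂ) * (T j k * A α k l * T l j)
        = ∑ j, ∑ k, ∑ l, (D j : ℂ) * (T j k * A α k l * T l j) :=
          Finset.sum_congr rfl fun j _ => Finset.sum_comm
      _ = ∑ k, ∑ l, ∑ j, (D j : ℂ) * (T j k * A α k l * T l j) := by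
          rw [Finset.sum_comm]
          exact Finset.sum_congr rfl fun k _ => Finset.sum_comm
      _ = _ := Finset.sum_congr rfl fun k _ => Finset.sum_congr rfl fun l _ =>
          Finset.sum_congr rfl fun j _ => by ring
  unfold gradNorm
  simp only [hder]
  rw [h.sum_norm_sq]
  have hbound : ∑ k, ∑ l, S k l * ‖M l k‖ ^ 2 ≤ σ * ((η⁻¹) ^ 2) ^ 2 * ∑ j, D j ^ 2 := by
    calc ∑ k, ∑ l, S k l * ‖M l k‖ ^ 2
        ≤ ∑ k, σ * ((η⁻¹) ^ 2 * ∑ j, ‖(D j : ℂ) * T j k‖ ^ 2) := by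
          refine Finset.sum_le_sum fun k _ => ?_
          refine le_trans (Finset.sum_le_sum fun l _ =>
            mul_le_mul_of_nonneg_right (hS k l) (sq_nonneg _)) ?_
          rw [← Finset.mul_sum]
          exact mul_le_mul_of_nonneg_left
            (sum_norm_sq_resolvent_mul_le hH hη ha fun j => (D j : ℂ) * T j k) hσ
      _ = σ * (η⁻¹) ^ 2 * ∑ j, D j ^ 2 * ∑ k, ‖T j k‖ ^ 2 := by
          simp only [norm_mul, mul_pow, Complex.norm_real, Real.norm_eq_abs, sq_abs,
            Finset.mul_sum]
          rw [Finset.sum_comm]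
          exact Finset.sum_congr rfl fun j _ => Finset.sum_congr rfl fun k _ => by ring
      _ ≤ σ * (η⁻¹) ^ 2 * ∑ j, D j ^ 2 * (η⁻¹) ^ 2 := by
          refine mul_le_mul_of_nonneg_left (Finset.sum_le_sum fun j _ =>
            mul_le_mul_of_nonneg_left ?_ (sq_nonneg _)) (by positivity)
          exact sum_norm_sq_resolvent_row_le hH hη ha j
      _ = _ := by rw [← Finset.sum_mul]; ring
  refine (Real.sqrt_le_sqrt hbound).trans (le_of_eq ?_)
  rw [Real.sqrt_mul (by positivity), Real.sqrt_mul hσ, Real.sqrt_sq (by positivity)]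

lemma gradNorm_gaussianResolvent_diag_le {S : Matrix n n ℝ} (h : HasProfile A S)
    (hY : Y.IsHermitian) (hη : 0 < η) (ha : ∀ k, η ≤ (a k).im) {σ : ℝ} (hσ : 0 ≤ σ)
    (hS : ∀ i j, S i j ≤ σ) (i : n) (g : ι → ℝ) :
    gradNorm (fun g => gaussianResolvent A Y a g i i) g ≤ √σ * (η⁻¹) ^ 2 := by
  have := gradNorm_sum_gaussianResolvent_le h hY hη ha hσ hS (Pi.single i 1) g
  simpa [Pi.single_apply, ite_pow, apply_ite Complex.ofReal] using this

end Resolvent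

end GaussianMatrix

/-! ### The approximate fixed point equation for the mean resolvent -/

section Bias

variable {n ι : Type*} [Fintype n] [DecidableEq n] [Fintype ι]
  {A : ι → Matrix n n ℂ} {Y : Matrix n n ℂ} {a : n → ℂ} {η : ℝ} {S : Matrix n n ℝ}

/-- The entries of the mean of the random resolvent. -/
noncomputable def meanResolvent (A : ι → Matrix n n ℂ) (Y : Matrix n n ℂ) (a : n → ℂ) :
    Matrix n n ℂ :=
  Matrix.of fun i j => ∫ g, gaussianResolvent A Y a g i j ∂(stdGaussianPi ι)

/-- The random vector `R(T)`, where `T` is the diagonal of the random resolvent. -/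
noncomputable def wavgResolvent (S : Matrix n n ℝ) (A : ι → Matrix n n ℂ) (Y : Matrix n n ℂ)
    (a : n → ℂ) (i : n) (g : ι → ℝ) : ℂ :=
  ∑ j, (S i j : ℂ) * gaussianResolvent A Y a g j j

/-- The covariance of `R(T) i` and `T i j`, where `T` is the random resolvent. -/
noncomputable def covResolvent (S : Matrix n n ℝ) (A : ι → Matrix n n ℂ) (Y : Matrix n n ℂ)
    (a : n → ℂ) : Matrix n n ℂ :=
  Matrix.of fun i j =>
    ∫ g, wavgResolvent S A Y a i g * gaussianResolvent A Y a g i j ∂(stdGaussianPi ι) -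
      (∫ g, wavgResolvent S A Y a i g ∂(stdGaussianPi ι)) *
        ∫ g, gaussianResolvent A Y a g i j ∂(stdGaussianPi ι)

lemma boundedC1_wavgResolvent (hA : ∀ α, (A α).IsHermitian) (hY : Y.IsHermitian)
    (hη : 0 < η) (ha : ∀ k, η ≤ (a k).im) (i : n) : BoundedC1 (wavgResolvent S A Y a i) :=
  BoundedC1.sum Finset.univ fun j =>
    (BoundedC1.const (S i j : ℂ)).mul (boundedC1_gaussianResolvent hA hY hη ha j j)

lemma integral_wavgResolvent (hA : ∀ α, (A α).IsHermitian) (hY : Y.IsHermitian)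
    (hη : 0 < η) (ha : ∀ k, η ≤ (a k).im) (i : n) :
    ∫ g, wavgResolvent S A Y a i g ∂(stdGaussianPi ι) =
      wavg S (fun j => meanResolvent A Y a j j) i := by
  unfold wavgResolvent
  rw [integral_finsetSum _ fun j _ =>
    (boundedC1_gaussianResolvent hA hY hη ha j j).integrable.const_mul _]
  simp only [integral_const_mul]
  rfl

lemma im_meanResolvent_le (hA : ∀ α, (A α).IsHermitian) (hY : Y.IsHermitian)
    (hη : 0 < η) (ha : ∀ k, η ≤ (a k).im) (k : n) : (meanResolvent A Y a k k).im ≤ 0 := by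
  have hi := (boundedC1_gaussianResolvent hA hY hη ha k k).integrable (μ := stdGaussianPi ι)
  have h1 := Complex.imCLM.integral_comp_comm hi
  simp only [Complex.imCLM_apply] at h1
  rw [meanResolvent, Matrix.of_apply, ← h1]
  exact integral_nonpos fun g => (neg_pos.mp (neg_im_resolvent_pos
    (isHermitian_add_gaussianMatrix hA hY g) (fun k => hη.trans_le (ha k)) k)).le

variable [DecidableEq ι]

/-- Gaussian integration by parts for the product of the Gaussian matrix and the resolvent. -/
lemma integral_gaussianMatrix_mul_resolvent (h : HasProfile A S) (hY : Y.IsHermitian)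
    (hη : 0 < η) (ha : ∀ k, η ≤ (a k).im) (i j : n) :
    ∫ g, (gaussianMatrix A g * gaussianResolvent A Y a g) i j ∂(stdGaussianPi ι) =
      ∫ g, wavgResolvent S A Y a i g * gaussianResolvent A Y a g i j ∂(stdGaussianPi ι) := by
  have hap : ∀ k, 0 < (a k).im := fun k => hη.trans_le (ha k)
  have hb := boundedC1_gaussianResolvent h.hermitian hY hη ha
  calc ∫ g, (gaussianMatrix A g * gaussianResolvent A Y a g) i j ∂(stdGaussianPi ι)
      = ∫ g, ∑ k, ∑ α, A α i k * ((g α : ℂ) * gaussianResolvent A Y a g k j)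
          ∂(stdGaussianPi ι) := by
        congr 1; ext g
        rw [Matrix.mul_apply]
        refine Finset.sum_congr rfl fun k _ => ?_
        rw [gaussianMatrix_apply, Finset.sum_mul]
        exact Finset.sum_congr rfl fun α _ => by ring
    _ = ∑ k, ∑ α, A α i k * ∫ g, (gaussianResolvent A Y a g * A α * gaussianResolvent A Y a g) k j
          ∂(stdGaussianPi ι) := by
        rw [integral_finsetSum _ fun k _ => integrable_finsetSum _ fun α _ =>
          (integrable_coord_mul (hb k j) α).const_mul _]
        refine Finset.sum_congr rfl fun k _ => ?_
        rw [integral_finsetSum _ fun α _ => (integrable_coord_mul (hb k j) α).const_mul _]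
        refine Finset.sum_congr rfl fun α _ => ?_
        rw [integral_const_mul, integral_coord_mul (hb k j)]
        simp only [fderiv_gaussianResolvent h.hermitian hY hap, gaussianMatrix_single]
    _ = ∫ g, ∑ k, ∑ α, A α i k *
          (gaussianResolvent A Y a g * A α * gaussianResolvent A Y a g) k j ∂(stdGaussianPi ι) := by
        have hi : ∀ k α, Integrable (fun g => (gaussianResolvent A Y a g * A α *
            gaussianResolvent A Y a g) k j) (stdGaussianPi ι) := by
          intro k α
          have := (hb k j).integrable_fderiv_apply (μ := stdGaussianPi ι) (Pi.single α 1)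
          simpa only [fderiv_gaussianResolvent h.hermitian hY hap, gaussianMatrix_single] using this
        rw [integral_finsetSum _ fun k _ => integrable_finsetSum _ fun α _ => (hi k α).const_mul _]
        refine Finset.sum_congr rfl fun k _ => ?_
        rw [integral_finsetSum _ fun α _ => (hi k α).const_mul _]
        simp only [integral_const_mul]
    _ = _ := by
        congr 1; ext g
        set T := gaussianResolvent A Y a g with hT
        calc ∑ k, ∑ α, A α i k * (T * A α * T) k j
            = ∑ k, ∑ p, ∑ q, (∑ α, A α i k * A α p q) * (T k p * T q j) := by
              simp only [Matrix.mul_apply, Finset.mul_sum, Finset.sum_mul]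
              refine Finset.sum_congr rfl fun k _ => ?_
              rw [Finset.sum_comm]
              rw [Finset.sum_comm]
              calc ∑ α, ∑ q, ∑ p, A α i k * (T k p * A α p q * T q j)
                  = ∑ α, ∑ p, ∑ q, A α i k * (T k p * A α p q * T q j) :=
                    Finset.sum_congr rfl fun α _ => Finset.sum_comm
                _ = ∑ p, ∑ q, ∑ α, A α i k * (T k p * A α p q * T q j) := by
                    rw [Finset.sum_comm]
                    exact Finset.sum_congr rfl fun p _ => Finset.sum_comm
                _ = _ := Finset.sum_congr rfl fun p _ => Finset.sum_congr rfl fun q _ =>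
                    Finset.sum_congr rfl fun α _ => by ring
          _ = _ := by
              simp only [h.covariance, wavgResolvent, Finset.sum_mul, ite_and, ite_mul, zero_mul]
              refine Finset.sum_congr rfl fun k _ => ?_
              rw [Finset.sum_comm]
              simp [← hT]
              ring

/-- The mean resolvent is, up to a covariance, the resolvent at the shifted spectral parameter. -/
lemma meanResolvent_eq (h : HasProfile A S) (hS : ∀ i j, 0 ≤ S i j) (hY : Y.IsHermitian)
    (hη : 0 < η) (ha : ∀ k, η ≤ (a k).im)
    (him : ∀ k, (meanResolvent A Y a k k).im ≤ 0) :
    meanResolvent A Y a =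
      resolvent Y (shift S a fun j => meanResolvent A Y a j j) *
        (1 + covResolvent S A Y a) := by
  have hap : ∀ k, 0 < (a k).im := fun k => hη.trans_le (ha k)
  have hb := boundedC1_gaussianResolvent h.hermitian hY hη ha
  set m : n → ℂ := fun j => meanResolvent A Y a j j with hm
  have key : (Matrix.diagonal (shift S a m) - Y) * meanResolvent A Y a =
      1 + covResolvent S A Y a := by
    ext i j
    have h1 : ∀ g, (Matrix.diagonal a - Y) * gaussianResolvent A Y a g =
        1 + gaussianMatrix A g * gaussianResolvent A Y a g := fun g => by
      have := mul_resolvent (isHermitian_add_gaussianMatrix h.hermitian hY g) hap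
      rw [← sub_sub, sub_mul] at this
      exact sub_eq_iff_eq_add.mp this
    have h2 : ∀ g, ((Matrix.diagonal a - Y) * gaussianResolvent A Y a g) i j =
        ∑ k, (Matrix.diagonal a - Y) i k * gaussianResolvent A Y a g k j := fun g =>
      Matrix.mul_apply
    have h3 : ∫ g, ((Matrix.diagonal a - Y) * gaussianResolvent A Y a g) i j ∂(stdGaussianPi ι) =
        ((Matrix.diagonal a - Y) * meanResolvent A Y a) i j := by
      simp only [h2]
      rw [integral_finsetSum _ fun k _ => (hb k j).integrable.const_mul _, Matrix.mul_apply]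
      simp only [integral_const_mul]
      rfl
    have h4 : ∫ g, ((Matrix.diagonal a - Y) * gaussianResolvent A Y a g) i j ∂(stdGaussianPi ι) =
        (1 : Matrix n n ℂ) i j + ∫ g, wavgResolvent S A Y a i g * gaussianResolvent A Y a g i j
          ∂(stdGaussianPi ι) := by
      rw [← integral_gaussianMatrix_mul_resolvent h hY hη ha]
      have hi : Integrable (fun g => (gaussianMatrix A g * gaussianResolvent A Y a g) i j)
          (stdGaussianPi ι) := by
        have : (fun g => (gaussianMatrix A g * gaussianResolvent A Y a g) i j) =
            fun g => ∑ k, (Matrix.diagonal a - Y) i k * gaussianResolvent A Y a g k j -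
              (1 : Matrix n n ℂ) i j := by
          ext g
          rw [← h2, h1, Matrix.add_apply, add_sub_cancel_left]
        rw [this]
        exact (integrable_finsetSum _ fun k _ => (hb k j).integrable.const_mul _).sub
          (integrable_const _)
      simp only [h1, Matrix.add_apply]
      rw [integral_add (integrable_const _) hi]
      simp
    have h5 : ((Matrix.diagonal (shift S a m) - Y) * meanResolvent A Y a) i j =
        ((Matrix.diagonal a - Y) * meanResolvent A Y a) i j -
          wavg S m i * meanResolvent A Y a i j := by
      simp only [sub_mul, Matrix.sub_apply, Matrix.diagonal_mul, shift]
      ring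
    rw [h5, ← h3, h4, Matrix.add_apply, covResolvent, Matrix.of_apply,
      integral_wavgResolvent h.hermitian hY hη ha, add_sub_assoc]
    rfl
  rw [← key, ← mul_assoc, resolvent_mul hY (im_shift_pos hS hap him), one_mul]

end Bias

section BiasBounds

variable {n ι : Type*} [Fintype n] [DecidableEq n] [Fintype ι]
  {A : ι → Matrix n n ℂ} {Y : Matrix n n ℂ} {a : n → ℂ} {η : ℝ} {S : Matrix n n ℝ}

lemma le_im_shift_meanResolvent (hA : ∀ α, (A α).IsHermitian) (hS : ∀ i j, 0 ≤ S i j)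
    (hY : Y.IsHermitian) (hη : 0 < η) (ha : ∀ k, η ≤ (a k).im) (k : n) :
    η ≤ (shift S a (fun j => meanResolvent A Y a j j) k).im :=
  (ha k).trans (im_le_im_shift hS (im_meanResolvent_le hA hY hη ha) k)

variable [DecidableEq ι]

lemma gradNorm_wavgResolvent_le (h : HasProfile A S) (hS : ∀ i j, 0 ≤ S i j)
    (hY : Y.IsHermitian) (hη : 0 < η) (ha : ∀ k, η ≤ (a k).im) {σ : ℝ} (hσ : 0 ≤ σ)
    (hSσ : ∀ i j, S i j ≤ σ) (i : n) (g : ι → ℝ) :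
    gradNorm (wavgResolvent S A Y a i) g ≤
      √σ * (η⁻¹) ^ 2 * (σ * √(Fintype.card n)) := by
  refine (gradNorm_sum_gaussianResolvent_le h hY hη ha hσ hSσ (S i) g).trans ?_
  refine mul_le_mul_of_nonneg_left ?_ (by positivity)
  rw [Real.sqrt_le_left (by positivity), mul_pow, Real.sq_sqrt (Nat.cast_nonneg _)]
  calc ∑ j, S i j ^ 2 ≤ ∑ _j : n, σ ^ 2 :=
        Finset.sum_le_sum fun j _ => pow_le_pow_left₀ (hS i j) (hSσ i j) 2
    _ = σ ^ 2 * Fintype.card n := by simp [mul_comm]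

lemma meanResolvent_diag_sub (h : HasProfile A S) (hS : ∀ i j, 0 ≤ S i j) (hY : Y.IsHermitian)
    (hη : 0 < η) (ha : ∀ k, η ≤ (a k).im) (i : n) :
    meanResolvent A Y a i i - resolvent Y (shift S a fun j => meanResolvent A Y a j j) i i =
      ∑ k, resolvent Y (shift S a fun j => meanResolvent A Y a j j) i k *
        covResolvent S A Y a k i := by
  have := congrArg (fun M : Matrix n n ℂ => M i i)
    (meanResolvent_eq h hS hY hη ha (im_meanResolvent_le h.hermitian hY hη ha))
  simp only [mul_add, mul_one, Matrix.add_apply] at this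
  rw [sub_eq_iff_eq_add', ← Matrix.mul_apply]
  exact this

/-- The error in the fixed point equation when `Y` is diagonal. Only the covariance of `R(T) i` with
the diagonal entry `T i i` enters, and both have small gradients. -/
lemma norm_meanResolvent_diag_sub_le_of_isDiag (h : HasProfile A S) (hS : ∀ i j, 0 ≤ S i j)
    (hY : Y.IsHermitian) (hYd : Y.IsDiag) (hη : 0 < η) (ha : ∀ k, η ≤ (a k).im) {σ κ : ℝ}
    (hσ : 0 ≤ σ) (hSσ : ∀ i j, S i j ≤ σ)
    (hκ : ∀ i g, gradNorm (wavgResolvent S A Y a i) g ≤ κ) (i : n) :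
    ‖meanResolvent A Y a i i - resolvent Y (shift S a fun j => meanResolvent A Y a j j) i i‖ ≤
      η⁻¹ * (κ * (√σ * (η⁻¹) ^ 2)) := by
  set b := shift S a fun j => meanResolvent A Y a j j with hb
  have hηb := le_im_shift_meanResolvent h.hermitian hS hY hη ha
  rw [← hb] at hηb
  have hd : ∀ k, k ≠ i → resolvent Y b i k = 0 := by
    intro k hk
    have h1 : resolvent Y b = Matrix.diagonal fun k => Ring.inverse (b - Y.diag) k := by
      rw [resolvent]
      conv_lhs => rw [← hYd.diagonal_diag, Matrix.diagonal_sub, Matrix.inv_diagonal]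
      rfl
    rw [h1, Matrix.diagonal_apply_ne _ hk.symm]
  rw [meanResolvent_diag_sub h hS hY hη ha, ← hb, Finset.sum_eq_single i
    (fun k _ hk => by rw [hd k hk, zero_mul]) (by simp), norm_mul]
  have hκ0 : 0 ≤ κ := (gradNorm_nonneg _ 0).trans (hκ i 0)
  refine mul_le_mul (norm_resolvent_apply_le hY hη hηb i i) ?_ (norm_nonneg _) (by positivity)
  have hT := boundedC1_gaussianResolvent h.hermitian hY hη ha i i
  refine (norm_covariance_le (boundedC1_wavgResolvent h.hermitian hY hη ha i) hT (hκ i)).trans ?_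
  refine mul_le_mul_of_nonneg_left ?_ hκ0
  calc _ ≤ ∫ _g, √σ * (η⁻¹) ^ 2 ∂(stdGaussianPi ι) :=
        integral_mono hT.integrable_gradNorm (integrable_const _) fun g =>
          gradNorm_gaussianResolvent_diag_le h hY hη ha hσ hSσ i g
    _ = _ := by simp

/-- The error in the fixed point equation for a general `Y`. -/
lemma norm_meanResolvent_diag_sub_le (h : HasProfile A S) (hS : ∀ i j, 0 ≤ S i j)
    (hY : Y.IsHermitian) (hη : 0 < η) (ha : ∀ k, η ≤ (a k).im) {κ : ℝ} (hκ0 : 0 < κ)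
    (hκ : ∀ i g, gradNorm (wavgResolvent S A Y a i) g ≤ κ) (i : n) :
    ‖meanResolvent A Y a i i - resolvent Y (shift S a fun j => meanResolvent A Y a j j) i i‖ ≤
      κ * (η⁻¹) ^ 2 := by
  set b := shift S a fun j => meanResolvent A Y a j j with hb
  have hηb := le_im_shift_meanResolvent h.hermitian hS hY hη ha
  rw [← hb] at hηb
  have hW := fun k => boundedC1_wavgResolvent (S := S) h.hermitian hY hη ha k
  have hT := fun k => boundedC1_gaussianResolvent h.hermitian hY hη ha k i
  have hcov : ∀ k, covResolvent S A Y a k i =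
      ∫ g, centered (wavgResolvent S A Y a k) g * gaussianResolvent A Y a g k i
        ∂(stdGaussianPi ι) := by
    intro k
    simp only [centered, sub_mul]
    rw [integral_sub ((hW k).mul (hT k)).integrable ((hT k).integrable.const_mul _),
      integral_const_mul]
    rfl
  have hint1 : ∀ k, Integrable (fun g => ‖gaussianResolvent A Y a g k i‖ ^ 2)
      (stdGaussianPi ι) := fun k => by
    simpa using (((hT k).pow 2).integrable (μ := stdGaussianPi ι)).norm
  have hint2 : ∀ k, Integrable (fun g => ‖centered (wavgResolvent S A Y a k) g‖ ^ 2)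
      (stdGaussianPi ι) := fun k => integrable_norm_centered_pow (hW k) 2
  -- the weights `κ` in the inequality `2 x y ≤ κ x ^ 2 + κ⁻¹ y ^ 2` balance the two sums below
  have hterm : ∀ k, ‖resolvent Y b i k * covResolvent S A Y a k i‖ ≤
      κ / 2 * ∫ g, ‖gaussianResolvent A Y a g k i‖ ^ 2 ∂(stdGaussianPi ι) +
        ‖resolvent Y b i k‖ ^ 2 * (κ / 2) := by
    intro k
    have h1 : ∫ g, ‖centered (wavgResolvent S A Y a k) g‖ ^ 2 ∂(stdGaussianPi ι) ≤ κ ^ 2 :=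
      integral_norm_centered_sq_le (hW k) (hκ k)
    calc ‖resolvent Y b i k * covResolvent S A Y a k i‖
        ≤ ∫ g, (κ / 2 * ‖gaussianResolvent A Y a g k i‖ ^ 2 + ‖resolvent Y b i k‖ ^ 2 / (2 * κ) *
            ‖centered (wavgResolvent S A Y a k) g‖ ^ 2) ∂(stdGaussianPi ι) := by
          rw [hcov, ← integral_const_mul]
          refine norm_integral_le_of_norm_le
            (((hint1 k).const_mul _).add ((hint2 k).const_mul _))
            (Filter.Eventually.of_forall fun g => ?_)
          rw [norm_mul, norm_mul]
          set x := ‖gaussianResolvent A Y a g k i‖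
          set y := ‖resolvent Y b i k‖
          set z := ‖centered (wavgResolvent S A Y a k) g‖
          have h2 : κ / 2 * x ^ 2 + y ^ 2 / (2 * κ) * z ^ 2 - y * (z * x) =
              (κ * x - y * z) ^ 2 / (2 * κ) := by
            field_simp; ring
          have h3 : 0 ≤ (κ * x - y * z) ^ 2 / (2 * κ) := by positivity
          linarith
      _ = κ / 2 * ∫ g, ‖gaussianResolvent A Y a g k i‖ ^ 2 ∂(stdGaussianPi ι) +
          ‖resolvent Y b i k‖ ^ 2 / (2 * κ) *
            ∫ g, ‖centered (wavgResolvent S A Y a k) g‖ ^ 2 ∂(stdGaussianPi ι) := by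
          rw [integral_add ((hint1 k).const_mul _) ((hint2 k).const_mul _), integral_const_mul,
            integral_const_mul]
      _ ≤ _ := by
          refine add_le_add le_rfl ((mul_le_mul_of_nonneg_left h1 (by positivity)).trans
            (le_of_eq ?_))
          field_simp
  rw [meanResolvent_diag_sub h hS hY hη ha, ← hb]
  refine (norm_sum_le _ _).trans ((Finset.sum_le_sum fun k _ => hterm k).trans ?_)
  rw [Finset.sum_add_distrib, ← Finset.mul_sum, ← Finset.sum_mul,
    ← integral_finsetSum _ fun k _ => hint1 k]
  have h1 : ∫ g, ∑ k, ‖gaussianResolvent A Y a g k i‖ ^ 2 ∂(stdGaussianPi ι) ≤ (η⁻¹) ^ 2 := by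
    calc _ ≤ ∫ _g, (η⁻¹) ^ 2 ∂(stdGaussianPi ι) :=
          integral_mono (integrable_finsetSum _ fun k _ => hint1 k) (integrable_const _) fun g =>
            sum_norm_sq_resolvent_col_le (isHermitian_add_gaussianMatrix h.hermitian hY g) hη ha i
      _ = _ := by simp
  have h2 := sum_norm_sq_resolvent_row_le hY hη hηb i
  nlinarith

/-- An approximate solution of the fixed point equation is close to the solution: it is an exact
solution for a perturbed spectral parameter. -/
lemma norm_sub_fixedPoint_le {m : n → ℂ} (hS : ∀ i j, 0 ≤ S i j) (hY : Y.IsHermitian)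
    (hη : 0 < η) (ha : ∀ k, η ≤ (a k).im) (hm : ∀ k, (m k).im ≤ 0) {τ ρ δ : ℝ} (hδ : 0 < δ)
    (hρ : ∀ i, ∑ j, S i j ≤ ρ)
    (hτ : ∀ i, ‖m i - resolvent Y (shift S a m) i i‖ ≤ τ) (hsmall : ρ * τ ≤ (1 - δ) * η) (i : n) :
    ‖m i - fixedPoint S Y a i‖ ≤ (1 + ρ / δ * (η⁻¹) ^ 2) * τ := by
  have hap : ∀ k, 0 < (a k).im := fun k => hη.trans_le (ha k)
  have hτ0 : 0 ≤ τ := (norm_nonneg _).trans (hτ i)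
  set w : n → ℂ := fun i => resolvent Y (shift S a m) i i with hw
  set Θ : n → ℂ := fun i => m i - w i with hΘ
  set a' : n → ℂ := fun i => a i - wavg S Θ i with ha'
  have hdiff : ∀ k, ‖a' k - a k‖ ≤ ρ * τ := fun k => by
    have h1 : a' k - a k = -wavg S Θ k := by simp [ha']
    rw [h1, norm_neg]
    exact (norm_wavg_le hS hτ k).trans (mul_le_mul_of_nonneg_right (hρ k) hτ0)
  have hshift : shift S a' w = shift S a m := by
    ext k
    have h2 : wavg S Θ k + wavg S w k = wavg S m k := by
      simp only [wavg, ← Finset.sum_add_distrib, hΘ]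
      exact Finset.sum_congr rfl fun j _ => by ring
    simp only [shift, ha', ← h2]
    ring
  have ha'η : ∀ k, δ * η ≤ (a' k).im := fun k => by
    have h3 := (Complex.abs_im_le_norm (a' k - a k)).trans (hdiff k)
    rw [Complex.sub_im] at h3
    have h4 := neg_abs_le ((a' k).im - (a k).im)
    have h5 := ha k
    linarith
  have hwneg : ∀ k, (w k).im < 0 := fun k =>
    neg_pos.mp (neg_im_resolvent_pos hY (im_shift_pos hS hap hm) k)
  obtain ⟨hGneg, hGfix⟩ := fixedPoint_spec hS hY hap
  have key := norm_fixedPoint_sub_le hS hY (mul_pos hδ hη) hη ha'η ha hwneg hGneg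
    (fun k => by rw [fixMap, hshift]) hGfix hdiff i
  calc ‖m i - fixedPoint S Y a i‖ ≤ ‖m i - w i‖ + ‖w i - fixedPoint S Y a i‖ :=
        norm_sub_le_norm_sub_add_norm_sub _ _ _
    _ ≤ τ + ρ * τ * ((δ * η)⁻¹ * η⁻¹) := add_le_add (hτ i) key
    _ = _ := by field_simp

end BiasBounds

/-! ### The Gaussian coordinates of a GUE matrix with a variance profile -/

section GUE

variable {N : ℕ}

/-- The positions on and below the diagonal. -/
abbrev LowerIdx (N : ℕ) : Type := {p : Fin N × Fin N // p.2 ≤ p.1}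

/-- The position on or below the diagonal which determines the entry `(i, j)`. -/
def lowerIdx (i j : Fin N) : LowerIdx N :=
  if h : j ≤ i then ⟨(i, j), h⟩ else ⟨(j, i), (not_le.mp h).le⟩

lemma lowerIdx_comm (i j : Fin N) : lowerIdx i j = lowerIdx j i := by
  unfold lowerIdx
  rcases lt_trichotomy i j with h | h | h
  · rw [dif_neg (not_le.mpr h), dif_pos h.le]
  · subst h; rfl
  · rw [dif_pos h.le, dif_neg (not_le.mpr h)]

lemma lowerIdx_eq_iff (i j k l : Fin N) :
    lowerIdx i j = lowerIdx k l ↔ (k = i ∧ l = j) ∨ (k = j ∧ l = i) := by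
  unfold lowerIdx
  split_ifs with h1 h2 h2 <;> simp only [Subtype.mk.injEq, Prod.mk.injEq] <;> grind

/-- The entry `(i, j)` of a GUE matrix is `∑ s, g s * gueCoef i j s`, where `g` is the standard
Gaussian vector of the two coordinates attached to its position. On the diagonal the second
coordinate is not used. -/
noncomputable def gueCoef (i j : Fin N) (s : Fin 2) : ℂ :=
  if i = j then (if s = 0 then 1 else 0)
  else if s = 0 then ((√2)⁻¹ : ℝ)
  else if j < i then ((√2)⁻¹ : ℝ) * Complex.I else -(((√2)⁻¹ : ℝ) * Complex.I)

lemma conj_gueCoef (i j : Fin N) (s : Fin 2) : conj (gueCoef i j s) = gueCoef j i s := by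
  unfold gueCoef
  rcases lt_trichotomy i j with h | h | h
  · simp only [if_neg h.ne, if_neg h.ne', if_neg h.not_gt, if_pos h]
    split_ifs <;> simp
  · subst h
    simp only [if_true]
    split_ifs <;> simp
  · simp only [if_neg h.ne, if_neg h.ne', if_neg h.not_gt, if_pos h]
    split_ifs <;> simp

lemma sum_gueCoef_mul_conj (i j : Fin N) : ∑ s, gueCoef i j s * gueCoef j i s = 1 := by
  have h2 : ((√2 : ℝ) : ℂ) * (√2 : ℝ) = 2 := by
    rw [← Complex.ofReal_mul, Real.mul_self_sqrt (by norm_num)]; norm_num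
  have h3 : (((√2)⁻¹ : ℝ) : ℂ) * ((√2)⁻¹ : ℝ) = 1 / 2 := by
    rw [Complex.ofReal_inv, ← mul_inv, h2]; norm_num
  rw [Fin.sum_univ_two]
  unfold gueCoef
  rcases lt_trichotomy i j with h | h | h
  · simp only [if_neg h.ne, if_neg h.ne', if_neg h.not_gt, if_pos h, if_true, one_ne_zero, if_false]
    linear_combination (1 - Complex.I * Complex.I) * h3 - (1 / 2 : ℂ) * Complex.I_mul_I
  · subst h; simp
  · simp only [if_neg h.ne, if_neg h.ne', if_neg h.not_gt, if_pos h, if_true, one_ne_zero, if_false]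
    linear_combination (1 - Complex.I * Complex.I) * h3 - (1 / 2 : ℂ) * Complex.I_mul_I

lemma sum_gueCoef_mul_self {i j : Fin N} (hij : i ≠ j) :
    ∑ s, gueCoef i j s * gueCoef i j s = 0 := by
  rw [Fin.sum_univ_two]
  unfold gueCoef
  simp only [if_neg hij, if_true, one_ne_zero, if_false]
  split_ifs <;> linear_combination (((√2)⁻¹ : ℝ) : ℂ) ^ 2 * Complex.I_mul_I

/-- The coefficient matrices of the GUE matrix with variance profile `Γ`. -/
noncomputable def profileCoef (Γ : Matrix (Fin N) (Fin N) ℝ) (α : LowerIdx N × Fin 2) :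
    Matrix (Fin N) (Fin N) ℂ :=
  Matrix.of fun i j =>
    if lowerIdx i j = α.1 then (√(Γ i j) : ℂ) * gueCoef i j α.2 / (√(N : ℝ) : ℂ) else 0

lemma hasProfile_profileCoef {Γ : Matrix (Fin N) (Fin N) ℝ} (hΓsymm : Γ.IsSymm)
    (hΓ : ∀ i j, 0 ≤ Γ i j) :
    HasProfile (profileCoef Γ) (Matrix.of fun i j => Γ i j / N) := by
  refine ⟨fun α => ?_, fun a b c d => ?_⟩
  · ext i j
    rw [Matrix.conjTranspose_apply]
    simp only [profileCoef, Matrix.of_apply]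
    rw [lowerIdx_comm j i, hΓsymm.apply i j]
    split_ifs
    · simp [conj_gueCoef]
    · simp
  · have h1 : ∑ α, profileCoef Γ α a b * profileCoef Γ α c d =
        if lowerIdx c d = lowerIdx a b then
          (√(Γ a b) : ℂ) * (√(Γ c d) : ℂ) / (N : ℂ) * ∑ s, gueCoef a b s * gueCoef c d s
        else 0 := by
      have hN : ((√(N : ℝ) : ℝ) : ℂ) * (√(N : ℝ) : ℝ) = N := by
        rw [← Complex.ofReal_mul, Real.mul_self_sqrt (Nat.cast_nonneg _)]; simp
      simp only [profileCoef, Matrix.of_apply, Fintype.sum_prod_type]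
      rw [Finset.sum_eq_single (lowerIdx a b)]
      · simp only [if_true]
        split_ifs
        · rw [Finset.mul_sum]
          refine Finset.sum_congr rfl fun s _ => ?_
          rw [div_mul_div_comm, hN]
          ring
        · simp
      · intro p _ hp
        simp [hp.symm]
      · simp
    rw [h1]
    have hsq : (√(Γ a b) : ℂ) * (√(Γ a b) : ℂ) = Γ a b := by
      rw [← Complex.ofReal_mul, Real.mul_self_sqrt (hΓ a b)]
    by_cases hab : a = d ∧ b = c
    · obtain ⟨rfl, rfl⟩ := hab
      rw [if_pos (lowerIdx_comm _ _), if_pos ⟨rfl, rfl⟩, sum_gueCoef_mul_conj, hΓsymm.apply a b, hsq]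
      simp
    · rw [if_neg hab]
      split_ifs with hl
      · rcases (lowerIdx_eq_iff _ _ _ _).mp hl with ⟨rfl, rfl⟩ | ⟨rfl, rfl⟩
        · rw [sum_gueCoef_mul_self (fun h => hab ⟨h, h.symm⟩), mul_zero]
        · exact absurd ⟨rfl, rfl⟩ hab
      · rfl

/-- The Hermitian matrix with prescribed entries on and below the diagonal. -/
noncomputable def hermitianOfLower (w : LowerIdx N → ℂ) (i j : Fin N) : ℂ :=
  if j ≤ i then w (lowerIdx i j) else conj (w (lowerIdx i j))

/-- The profile matrix as a function of the entries on and below the diagonal. -/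
noncomputable def profileOfLower (Γ : Matrix (Fin N) (Fin N) ℝ) (w : LowerIdx N → ℂ) :
    Matrix (Fin N) (Fin N) ℂ :=
  Matrix.of fun i j => (√(Γ i j) : ℂ) * hermitianOfLower w i j / (√(N : ℝ) : ℂ)

/-- The entries on and below the diagonal of a GUE matrix, as functions of Gaussian coordinates. -/
noncomputable def gueLower (p : LowerIdx N) (k : Fin 2 → ℝ) : ℂ :=
  ∑ s, (k s : ℂ) * gueCoef p.1.1 p.1.2 s

lemma continuous_gueLower (p : LowerIdx N) : Continuous (gueLower p) := by
  unfold gueLower; fun_prop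

lemma profileMatrix_eq {Ω : Type*} [MeasurableSpace Ω] {P : Measure Ω} {x : Fin N → Fin N → Ω → ℂ}
    (hx : IsStandardGUE x P) (Γ : Matrix (Fin N) (Fin N) ℝ) (ω : Ω) :
    profileMatrix Γ x ω = profileOfLower Γ fun p => x p.1.1 p.1.2 ω := by
  ext i j
  simp only [profileMatrix, profileOfLower, Matrix.of_apply, hermitianOfLower, lowerIdx]
  split_ifs with h
  · rfl
  · rw [← hx.hermitian]

lemma gaussianMatrix_profileCoef (Γ : Matrix (Fin N) (Fin N) ℝ) (g : LowerIdx N × Fin 2 → ℝ) :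
    gaussianMatrix (profileCoef Γ) g =
      profileOfLower Γ fun p => gueLower p fun s => g (p, s) := by
  ext i j
  rw [gaussianMatrix_apply, Fintype.sum_prod_type, Finset.sum_eq_single (lowerIdx i j)]
  · have h1 : hermitianOfLower (fun p => gueLower p fun s => g (p, s)) i j =
        ∑ s, (g (lowerIdx i j, s) : ℂ) * gueCoef i j s := by
      unfold hermitianOfLower gueLower
      split_ifs with h
      · have : (lowerIdx i j).1 = (i, j) := by unfold lowerIdx; rw [dif_pos h]
        simp only [this]
      · have : (lowerIdx i j).1 = (j, i) := by unfold lowerIdx; rw [dif_neg h]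
        simp only [this, map_sum]
        refine Finset.sum_congr rfl fun s _ => ?_
        rw [map_mul, conj_gueCoef, Complex.conj_ofReal]
    simp only [profileOfLower, Matrix.of_apply, h1, profileCoef, if_true, Finset.mul_sum,
      Finset.sum_div]
    exact Finset.sum_congr rfl fun s _ => by ring
  · intro p _ hp
    refine Finset.sum_eq_zero fun s _ => ?_
    simp [profileCoef, hp.symm]
  · simp

lemma continuous_profileOfLower (Γ : Matrix (Fin N) (Fin N) ℝ) :
    Continuous (profileOfLower Γ) := by
  refine continuous_matrix fun i j => ?_
  simp only [profileOfLower, Matrix.of_apply, hermitianOfLower]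
  split_ifs
  · fun_prop
  · exact (continuous_const.mul (Complex.continuous_conj.comp (continuous_apply _))).div_const _

/-- The law of an entry on or below the diagonal of a standard GUE matrix. -/
noncomputable def gueEntryLaw (p : LowerIdx N) : Measure ℂ :=
  if p.1.1 = p.1.2 then (gaussianReal 0 1).map Complex.ofReal else complexGaussian

lemma map_gueLower (p : LowerIdx N) :
    (stdGaussianPi (Fin 2)).map (gueLower p) = gueEntryLaw p := by
  unfold gueEntryLaw
  split_ifs with h
  · have h1 : gueLower p = Complex.ofReal ∘ Function.eval 0 := by
      ext k
      simp [gueLower, gueCoef, h]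
    rw [h1, ← Measure.map_map (by fun_prop) (by fun_prop),
      (measurePreserving_eval (fun _ : Fin 2 => gaussianReal 0 1) 0).map_eq]
  · have hlt : p.1.2 < p.1.1 := lt_of_le_of_ne p.2 (Ne.symm h)
    have h1 : gueLower p = (fun q : ℝ × ℝ => (⟨q.1, q.2⟩ : ℂ)) ∘
        (Prod.map ((√2)⁻¹ * ·) ((√2)⁻¹ * ·)) ∘ (MeasurableEquiv.finTwoArrow (α := ℝ)) := by
      ext k
      apply Complex.ext <;>
        simp [gueLower, gueCoef, h, hlt, Fin.sum_univ_two, MeasurableEquiv.finTwoArrow, mul_comm,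
          Real.sqrt_div_self]
    have hm : Measurable fun q : ℝ × ℝ => (⟨q.1, q.2⟩ : ℂ) :=
      Complex.measurableEquivRealProd.symm.measurable
    have hscale : (gaussianReal 0 1).map ((√2)⁻¹ * ·) = gaussianReal 0 (1 / 2) := by
      rw [gaussianReal_map_const_mul]
      congr 1
      · simp
      · ext; simp
    rw [h1, ← Measure.map_map hm (by fun_prop), ← Measure.map_map (by fun_prop) (by fun_prop),
      (measurePreserving_finTwoArrow (gaussianReal 0 1)).map_eq,
      ← Measure.map_prod_map _ _ (by fun_prop) (by fun_prop), hscale]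
    rfl

lemma hasLaw_entry {Ω : Type*} [MeasurableSpace Ω] {P : Measure Ω} {x : Fin N → Fin N → Ω → ℂ}
    (hx : IsStandardGUE x P) (p : LowerIdx N) : HasLaw (x p.1.1 p.1.2) (gueEntryLaw p) P := by
  unfold gueEntryLaw
  split_ifs with h
  · have h1 : x p.1.1 p.1.2 = Complex.ofReal ∘ fun ω => (x p.1.1 p.1.1 ω).re := by
      ext ω
      have := hx.hermitian p.1.1 p.1.1 ω
      rw [← h]
      exact (Complex.conj_eq_iff_re.mp this.symm).symm
    rw [h1]
    have h2 := hx.diag_law p.1.1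
    refine ⟨Complex.measurable_ofReal.comp_aemeasurable h2.aemeasurable, ?_⟩
    rw [← h2.map_eq, AEMeasurable.map_map_of_aemeasurable
      Complex.measurable_ofReal.aemeasurable h2.aemeasurable]
  · exact hx.offDiag_law _ _ h

lemma map_uncurry_pi_stdGaussianPi (ι κ : Type*) [Fintype ι] [Fintype κ] :
    (Measure.pi fun _ : ι => stdGaussianPi κ).map (fun (k : ι → κ → ℝ) (q : ι × κ) => k q.1 q.2) =
      stdGaussianPi (ι × κ) := by
  refine (Measure.pi_eq fun s hs => ?_).symm
  rw [Measure.map_apply (by fun_prop) (MeasurableSet.univ_pi hs)]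
  have : (fun (k : ι → κ → ℝ) (q : ι × κ) => k q.1 q.2) ⁻¹' Set.univ.pi s =
      Set.univ.pi fun i => Set.univ.pi fun j => s (i, j) := by
    ext k; simp
  rw [this, Measure.pi_pi, Fintype.prod_prod_type]
  simp only [Measure.pi_pi]

/-- Probabilities of events of the profile matrix can be computed for a standard Gaussian vector of
coordinates. -/
lemma measure_profileMatrix_eq {Ω : Type*} [MeasurableSpace Ω] {P : Measure Ω}
    [IsProbabilityMeasure P] {x : Fin N → Fin N → Ω → ℂ} (hx : IsStandardGUE x P)
    (Γ : Matrix (Fin N) (Fin N) ℝ) {B : Set (Matrix (Fin N) (Fin N) ℂ)}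
    (hB : MeasurableSet (profileOfLower Γ ⁻¹' B)) :
    P {ω | profileMatrix Γ x ω ∈ B} =
      stdGaussianPi (LowerIdx N × Fin 2) {g | gaussianMatrix (profileCoef Γ) g ∈ B} := by
  have hlaw : HasLaw (fun ω (p : LowerIdx N) => x p.1.1 p.1.2 ω) (Measure.pi gueEntryLaw) P :=
    iIndepFun.hasLaw_pi (fun p => hasLaw_entry hx p) hx.indep
  have e1 : {ω | profileMatrix Γ x ω ∈ B} =
      (fun ω (p : LowerIdx N) => x p.1.1 p.1.2 ω) ⁻¹' (profileOfLower Γ ⁻¹' B) := by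
    ext ω
    rw [Set.mem_ofPred_eq, profileMatrix_eq hx]
    rfl
  have hmeas : Measurable fun (k : LowerIdx N → Fin 2 → ℝ) p => gueLower p (k p) :=
    measurable_pi_lambda _ fun p => (continuous_gueLower p).measurable.comp (measurable_pi_apply p)
  have hpi : (Measure.pi fun _ : LowerIdx N => stdGaussianPi (Fin 2)).map
      (fun k p => gueLower p (k p)) = Measure.pi gueEntryLaw := by
    have : ∀ p : LowerIdx N, IsProbabilityMeasure ((stdGaussianPi (Fin 2)).map (gueLower p)) :=
      fun p => Measure.isProbabilityMeasure_map (continuous_gueLower p).aemeasurable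
    rw [Measure.pi_map_pi fun p => (continuous_gueLower p).aemeasurable]
    simp only [map_gueLower]
  have hgmeas : MeasurableSet {g : LowerIdx N × Fin 2 → ℝ | gaussianMatrix (profileCoef Γ) g ∈ B} := by
    have : Measurable fun (g : LowerIdx N × Fin 2 → ℝ) (p : LowerIdx N) =>
        gueLower p fun s => g (p, s) :=
      measurable_pi_lambda _ fun p => (continuous_gueLower p).measurable.comp
        (measurable_pi_lambda _ fun s => measurable_pi_apply (p, s))
    simp only [gaussianMatrix_profileCoef]
    exact this hB
  rw [e1, ← Measure.map_apply_of_aemeasurable hlaw.aemeasurable hB, hlaw.map_eq, ← hpi,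
    Measure.map_apply hmeas hB, ← map_uncurry_pi_stdGaussianPi (LowerIdx N) (Fin 2),
    Measure.map_apply (by fun_prop) hgmeas]
  congr 1
  ext k
  simp only [Set.mem_preimage, Set.mem_ofPred_eq, gaussianMatrix_profileCoef]

end GUE

/-! ### The deterministic equivalent -/

section DeterministicEquivalent

variable {N : ℕ}

/-- The variances `γ²(i,j) / N` of the entries of the profile matrix. -/
noncomputable def varianceMatrix (Γ : Matrix (Fin N) (Fin N) ℝ) : Matrix (Fin N) (Fin N) ℝ :=
  Matrix.of fun i j => Γ i j / N

lemma varianceMatrix_nonneg {Γ : Matrix (Fin N) (Fin N) ℝ} (hΓ : ∀ i j, 0 ≤ Γ i j) (i j : Fin N) :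
    0 ≤ varianceMatrix Γ i j := div_nonneg (hΓ i j) (Nat.cast_nonneg N)

/-- The deterministic equivalent, as the diagonal matrix of the solution of the fixed point
equation. -/
noncomputable def detEquiv (Γ : Matrix (Fin N) (Fin N) ℝ) (Y Λ : Matrix (Fin N) (Fin N) ℂ) :
    Matrix (Fin N) (Fin N) ℂ :=
  Matrix.diagonal (fixedPoint (varianceMatrix Γ) Y Λ.diag)

lemma diagPart_inv_eq_diagonal_fixMap (Γ : Matrix (Fin N) (Fin N) ℝ)
    {Y Λ : Matrix (Fin N) (Fin N) ℂ} (hΛ : Λ.IsDiag) (W : Matrix (Fin N) (Fin N) ℂ) :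
    diagPart (Λ - covMap Γ W - Y)⁻¹ =
      Matrix.diagonal (fixMap (varianceMatrix Γ) Y Λ.diag W.diag) := by
  have h : Λ - covMap Γ W = Matrix.diagonal (shift (varianceMatrix Γ) Λ.diag W.diag) := by
    conv_lhs => rw [← hΛ.diagonal_diag, covMap, Matrix.diagonal_sub]
    rfl
  rw [h]
  rfl

lemma IsDeterministicEquivalent.eq_detEquiv {Γ : Matrix (Fin N) (Fin N) ℝ}
    (hΓ : ∀ i j, 0 ≤ Γ i j) {Y : Matrix (Fin N) (Fin N) ℂ} (hY : Y.IsHermitian)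
    {G : Matrix (Fin N) (Fin N) ℂ → Matrix (Fin N) (Fin N) ℂ}
    (hG : IsDeterministicEquivalent Γ Y G) : Set.EqOn G (detEquiv Γ Y) (diagPlus N) := by
  intro Λ hΛ
  obtain ⟨hdiag, hneg⟩ := hG.mapsTo hΛ
  have hfix := hG.fixedPoint Λ hΛ
  rw [diagPart_inv_eq_diagonal_fixMap Γ hΛ.1] at hfix
  obtain ⟨h1, h2⟩ := fixedPoint_spec (varianceMatrix_nonneg hΓ) hY (a := Λ.diag) hΛ.2
  have h3 : (G Λ).diag = DeformedGUE.fixedPoint (varianceMatrix Γ) Y Λ.diag := by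
    refine fixedPoint_unique (varianceMatrix_nonneg hΓ) hY hΛ.2 hneg h1 (fun k => ?_) h2
    conv_rhs => rw [hfix, Matrix.diag_diagonal]
    rfl
  rw [detEquiv, ← h3, hdiag.diagonal_diag]

lemma isDeterministicEquivalent_detEquiv {Γ : Matrix (Fin N) (Fin N) ℝ}
    (hΓ : ∀ i j, 0 ≤ Γ i j) {Y : Matrix (Fin N) (Fin N) ℂ} (hY : Y.IsHermitian) :
    IsDeterministicEquivalent Γ Y (detEquiv Γ Y) where
  mapsTo Λ hΛ := by
    obtain ⟨h1, -⟩ := fixedPoint_spec (varianceMatrix_nonneg hΓ) hY (a := Λ.diag) hΛ.2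
    exact ⟨Matrix.isDiag_diagonal _, fun i => by simpa [detEquiv] using h1 i⟩
  analytic v hv i k l := by
    have hopen : IsOpen {z : ℂ | 0 < z.im} := isOpen_lt continuous_const Complex.continuous_im
    refine DifferentiableOn.analyticOnNhd ?_ hopen
    simp only [detEquiv, Matrix.diag_diagonal]
    by_cases hkl : k = l
    · subst hkl
      simp only [Matrix.diagonal_apply_eq]
      refine differentiableOn_fixedPoint (varianceMatrix_nonneg hΓ) hY hopen ?_ ?_ k
      · refine differentiableOn_pi.mpr fun j => ?_
        by_cases hj : j = i
        · subst hj; simpa using! differentiableOn_id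
        · simp [hj]
      · intro z hz j
        by_cases hj : j = i
        · subst hj; simpa using hz
        · simpa [hj] using hv j
    · simp only [Matrix.diagonal_apply_ne _ hkl]
      exact differentiableOn_const _
  fixedPoint Λ hΛ := by
    obtain ⟨-, h2⟩ := fixedPoint_spec (varianceMatrix_nonneg hΓ) hY (a := Λ.diag) hΛ.2
    rw [diagPart_inv_eq_diagonal_fixMap Γ hΛ.1, detEquiv, Matrix.diag_diagonal]
    congr 1
    ext k
    exact (h2 k).symm

end DeterministicEquivalent

/-! ### The deviation bound -/

section Deviation

variable {N : ℕ}

lemma exists_invImNorm_eq (hN : 1 ≤ N) {Λ : Matrix (Fin N) (Fin N) ℂ} (hΛ : Λ ∈ diagPlus N) :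
    0 < invImNorm Λ ∧ (∀ k, (invImNorm Λ)⁻¹ ≤ (Λ k k).im) ∧
      ∃ k, (invImNorm Λ)⁻¹ = (Λ k k).im := by
  have : Nonempty (Fin N) := ⟨⟨0, hN⟩⟩
  have h1 : (ℑ Λ : Matrix (Fin N) (Fin N) ℂ) =
      Matrix.diagonal fun k => (((Λ k k).im : ℝ) : ℂ) := by
    rw [imaginaryPart_apply_coe]
    ext i j
    by_cases hij : i = j
    · subst hij
      apply Complex.ext <;> simp [Matrix.star_apply]; ring
    · rw [Matrix.diagonal_apply_ne _ hij]
      simp [Matrix.star_apply, hΛ.1 hij, hΛ.1 (Ne.symm hij)]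
  have h2 : (ℑ Λ : Matrix (Fin N) (Fin N) ℂ)⁻¹ =
      Matrix.diagonal fun k => (((Λ k k).im : ℝ) : ℂ)⁻¹ := by
    rw [h1]
    refine Matrix.inv_eq_right_inv ?_
    rw [Matrix.diagonal_mul_diagonal, ← Matrix.diagonal_one]
    congr 1
    ext k
    exact mul_inv_cancel₀ (by exact_mod_cast (hΛ.2 k).ne')
  have h3 : invImNorm Λ = ‖fun k => (((Λ k k).im : ℝ) : ℂ)⁻¹‖ := by
    rw [invImNorm, h2, Matrix.l2_opNorm_diagonal]
  obtain ⟨k₀, hk₀⟩ := Finite.exists_min fun k => (Λ k k).im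
  have hnorm : ∀ k, ‖(((Λ k k).im : ℝ) : ℂ)⁻¹‖ = (Λ k k).im⁻¹ := fun k => by
    rw [norm_inv, Complex.norm_real, Real.norm_of_nonneg (hΛ.2 k).le]
  have h4 : invImNorm Λ = (Λ k₀ k₀).im⁻¹ := by
    rw [h3]
    refine le_antisymm ((pi_norm_le_iff_of_nonempty _).mpr fun k => ?_) ?_
    · rw [hnorm]
      exact inv_anti₀ (hΛ.2 k₀) (hk₀ k)
    · rw [← hnorm]
      exact norm_le_pi_norm (fun k => (((Λ k k).im : ℝ) : ℂ)⁻¹) k₀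
  rw [h4, inv_inv]
  exact ⟨inv_pos.mpr (hΛ.2 k₀), hk₀, k₀, rfl⟩

lemma ImGE.le_inv_invImNorm (hN : 1 ≤ N) {Λ : Matrix (Fin N) (Fin N) ℂ} (hΛ : Λ ∈ diagPlus N)
    {c : ℝ} (h : ImGE Λ c) : c ≤ (invImNorm Λ)⁻¹ := by
  obtain ⟨-, -, k, hk⟩ := exists_invImNorm_eq hN hΛ
  have h1 := h.diag_nonneg (i := k)
  rw [hk]
  have h2 : ((ℑ Λ : Matrix (Fin N) (Fin N) ℂ) k k).re = (Λ k k).im := by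
    rw [imaginaryPart_apply_coe]
    simp [Matrix.star_apply]
    ring
  have h3 := (Complex.le_def.mp h1).1
  simp [h2] at h3
  exact h3

lemma le_gammaMax_sq {Γ : Matrix (Fin N) (Fin N) ℝ} (hΓ : ∀ i j, 0 ≤ Γ i j) (i j : Fin N) :
    Γ i j ≤ gammaMax Γ ^ 2 := by
  have h : Γ i j ≤ ⨆ p : Fin N × Fin N, Γ p.1 p.2 :=
    le_ciSup (f := fun p : Fin N × Fin N => Γ p.1 p.2) (Set.finite_range _).bddAbove (i, j)
  rw [gammaMax, Real.sq_sqrt ((hΓ i j).trans h)]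
  exact h

lemma gammaMax_pos {Γ : Matrix (Fin N) (Fin N) ℝ} (hΓ : ∀ i j, 0 ≤ Γ i j) (h0 : Γ ≠ 0) :
    0 < gammaMax Γ := by
  refine (Real.sqrt_nonneg _).lt_of_ne' fun h => h0 ?_
  ext i j
  have h1 := le_gammaMax_sq hΓ i j
  rw [gammaMax, h, zero_pow two_ne_zero] at h1
  exact le_antisymm h1 (hΓ i j)

lemma opStieltjes_sub_detEquiv (Γ : Matrix (Fin N) (Fin N) ℝ) {Y Λ : Matrix (Fin N) (Fin N) ℂ}
    (hΛ : Λ.IsDiag) (X : Matrix (Fin N) (Fin N) ℂ) :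
    ‖opStieltjes (X + Y) Λ - detEquiv Γ Y Λ‖ =
      ‖fun i => resolvent (Y + X) Λ.diag i i - fixedPoint (varianceMatrix Γ) Y Λ.diag i‖ := by
  rw [opStieltjes, diagPart, detEquiv, Matrix.diagonal_sub, Matrix.l2_opNorm_diagonal, resolvent,
    hΛ.diagonal_diag, add_comm X Y]
  rfl

lemma measurableSet_deviation (Γ : Matrix (Fin N) (Fin N) ℝ) {Y Λ : Matrix (Fin N) (Fin N) ℂ}
    (hΛ : Λ.IsDiag) (ε : ℝ) :
    MeasurableSet (profileOfLower Γ ⁻¹' {X | ε ≤ ‖opStieltjes (X + Y) Λ - detEquiv Γ Y Λ‖}) := by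
  simp only [opStieltjes_sub_detEquiv Γ hΛ]
  refine measurableSet_le measurable_const (Measurable.norm (measurable_pi_lambda _ fun i =>
    Measurable.sub_const ?_ _))
  have hc : Continuous fun w => Matrix.diagonal Λ.diag - (Y + profileOfLower Γ w) :=
    continuous_const.sub (continuous_const.add (continuous_profileOfLower Γ))
  have h : ∀ w, resolvent (Y + profileOfLower Γ w) Λ.diag i i =
      ((Matrix.diagonal Λ.diag - (Y + profileOfLower Γ w)).det)⁻¹ *
        (Matrix.diagonal Λ.diag - (Y + profileOfLower Γ w)).adjugate i i := fun w => by
    rw [resolvent, Matrix.inv_def, Matrix.smul_apply, Ring.inverse_eq_inv', smul_eq_mul]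
  simp only [h]
  exact hc.matrix_det.measurable.inv.mul (hc.matrix_adjugate.matrix_elem i i).measurable

/-- The deviation bound, given a bound `τ` on the error with which the mean of the diagonal of the
resolvent solves the fixed point equation. -/
lemma measureReal_deviation_le (hN : 1 ≤ N) {Γ : Matrix (Fin N) (Fin N) ℝ} (hΓsymm : Γ.IsSymm)
    (hΓ : ∀ i j, 0 ≤ Γ i j) (hΓ0 : Γ ≠ 0) {Y : Matrix (Fin N) (Fin N) ℂ} (hY : Y.IsHermitian)
    {Ω : Type*} [MeasurableSpace Ω] {P : Measure Ω} [IsProbabilityMeasure P]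
    {x : Fin N → Fin N → Ω → ℂ} (hx : IsStandardGUE x P) {δ : ℝ} (hδ : 0 < δ)
    {Λ : Matrix (Fin N) (Fin N) ℂ} (hΛ : Λ ∈ diagPlus N) {d : ℝ} (hd : 0 ≤ d) {τ : ℝ}
    (hτ : ∀ i, ‖meanResolvent (profileCoef Γ) Y Λ.diag i i - resolvent Y (shift (varianceMatrix Γ)
      Λ.diag fun j => meanResolvent (profileCoef Γ) Y Λ.diag j j) i i‖ ≤ τ)
    (hsmall : gammaMax Γ ^ 2 * τ ≤ (1 - δ) * (invImNorm Λ)⁻¹) :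
    P.real {ω | √2 * gammaMax Γ * √(d * Real.log N / N) * invImNorm Λ ^ 2 +
        (1 + gammaMax Γ ^ 2 / δ * invImNorm Λ ^ 2) * τ ≤
          ‖opStieltjes (profileMatrix Γ x ω + Y) Λ - detEquiv Γ Y Λ‖} ≤ 4 * (N : ℝ) ^ (1 - d) := by
  have : Nonempty (Fin N) := ⟨⟨0, hN⟩⟩
  obtain ⟨hm0, hmle, -⟩ := exists_invImNorm_eq hN hΛ
  set g := gammaMax Γ with hg
  set m := invImNorm Λ with hm
  have hg0 : 0 < g := gammaMax_pos hΓ hΓ0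
  have hNpos : (0 : ℝ) < N := by exact_mod_cast hN
  have hη : 0 < m⁻¹ := inv_pos.mpr hm0
  have hprof : HasProfile (profileCoef Γ) (varianceMatrix Γ) := hasProfile_profileCoef hΓsymm hΓ
  set σ := g ^ 2 / N with hσ
  have hσ0 : 0 ≤ σ := by positivity
  have hSσ : ∀ i j, varianceMatrix Γ i j ≤ σ := fun i j =>
    div_le_div_of_nonneg_right (le_gammaMax_sq hΓ i j) hNpos.le
  have hrow : ∀ i, ∑ j, varianceMatrix Γ i j ≤ g ^ 2 := fun i => by
    refine (Finset.sum_le_sum fun j _ => hSσ i j).trans (le_of_eq ?_)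
    simp only [Finset.sum_const, Finset.card_univ, Fintype.card_fin, nsmul_eq_mul, hσ]
    field_simp
  set t := √2 * g * √(d * Real.log N / N) * m ^ 2 with ht
  have ht0 : 0 ≤ t := by positivity
  set T := fun i => fun v => gaussianResolvent (profileCoef Γ) Y Λ.diag v i i with hT
  have hTb : ∀ i, BoundedC1 (T i) := fun i =>
    boundedC1_gaussianResolvent hprof.hermitian hY hη hmle i i
  set L := √σ * m ^ 2 with hL
  have hLpos : 0 < L := by
    have : 0 < σ := by positivity
    positivity
  have hgrad : ∀ i v, gradNorm (T i) v ≤ L := fun i v => by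
    have := gradNorm_gaussianResolvent_diag_le hprof hY hη hmle hσ0 hSσ i v
    rwa [inv_inv] at this
  have hlog : 0 ≤ Real.log N := Real.log_nonneg (by exact_mod_cast hN)
  have hexp : Real.exp (-(t ^ 2 / (2 * L ^ 2))) = (N : ℝ) ^ (-d) := by
    have h1 : t ^ 2 / (2 * L ^ 2) = d * Real.log N := by
      rw [ht, hL]
      simp only [mul_pow]
      rw [Real.sq_sqrt (by norm_num), Real.sq_sqrt (by positivity), Real.sq_sqrt hσ0, hσ]
      field_simp
    rw [h1, Real.rpow_def_of_pos hNpos]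
    congr 1; ring
  have hconc : ∀ i, (stdGaussianPi (LowerIdx N × Fin 2)).real {v | t ≤ ‖centered (T i) v‖} ≤
      2 * (N : ℝ) ^ (-d) := fun i => by
    rw [← hexp]
    exact measureReal_le_norm_centered_le (hTb i) hLpos (hgrad i) ht0
  have hbias : ∀ i, ‖meanResolvent (profileCoef Γ) Y Λ.diag i i -
      fixedPoint (varianceMatrix Γ) Y Λ.diag i‖ ≤ (1 + g ^ 2 / δ * m ^ 2) * τ := fun i => by
    have := norm_sub_fixedPoint_le (varianceMatrix_nonneg hΓ) hY hη hmle
      (im_meanResolvent_le hprof.hermitian hY hη hmle) hδ hrow hτ hsmall i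
    rwa [inv_inv] at this
  set ε := t + (1 + g ^ 2 / δ * m ^ 2) * τ with hε
  have hmeas := measure_profileMatrix_eq hx Γ
    (B := {X | ε ≤ ‖opStieltjes (X + Y) Λ - detEquiv Γ Y Λ‖})
    (measurableSet_deviation Γ hΛ.1 ε)
  have hsub : {v | gaussianMatrix (profileCoef Γ) v ∈
      {X | ε ≤ ‖opStieltjes (X + Y) Λ - detEquiv Γ Y Λ‖}} ⊆
      ⋃ i ∈ (Finset.univ : Finset (Fin N)), {v | t ≤ ‖centered (T i) v‖} := by
    intro v hv
    simp only [Set.mem_ofPred_eq] at hv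
    rw [opStieltjes_sub_detEquiv Γ hΛ.1] at hv
    by_contra hcon
    simp only [Finset.mem_univ, Set.iUnion_true, Set.mem_iUnion, Set.mem_ofPred_eq, not_exists,
      not_le] at hcon
    have hε0 : 0 < ε :=
      add_pos_of_pos_of_nonneg ((norm_nonneg _).trans_lt (hcon ⟨0, hN⟩))
        ((norm_nonneg _).trans (hbias ⟨0, hN⟩))
    refine absurd hv (not_le.mpr ((pi_norm_lt_iff hε0).mpr fun i => ?_))
    calc ‖resolvent (Y + gaussianMatrix (profileCoef Γ) v) Λ.diag i i -
          fixedPoint (varianceMatrix Γ) Y Λ.diag i‖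
        ≤ ‖centered (T i) v‖ + ‖meanResolvent (profileCoef Γ) Y Λ.diag i i -
            fixedPoint (varianceMatrix Γ) Y Λ.diag i‖ :=
          norm_sub_le_norm_sub_add_norm_sub _ _ _
      _ < ε := add_lt_add_of_lt_of_le (hcon i) (hbias i)
  calc P.real {ω | ε ≤ ‖opStieltjes (profileMatrix Γ x ω + Y) Λ - detEquiv Γ Y Λ‖}
      = (stdGaussianPi (LowerIdx N × Fin 2)).real {v | gaussianMatrix (profileCoef Γ) v ∈
          {X | ε ≤ ‖opStieltjes (X + Y) Λ - detEquiv Γ Y Λ‖}} :=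
        congrArg ENNReal.toReal hmeas
    _ ≤ ∑ i, (stdGaussianPi (LowerIdx N × Fin 2)).real {v | t ≤ ‖centered (T i) v‖} :=
        (measureReal_mono hsub (measure_ne_top _ _)).trans (measureReal_biUnion_finset_le _ _)
    _ ≤ ∑ _i : Fin N, 2 * (N : ℝ) ^ (-d) := Finset.sum_le_sum fun i _ => hconc i
    _ = 2 * (N : ℝ) ^ (1 - d) := by
        rw [sub_eq_add_neg, Real.rpow_add hNpos, Real.rpow_one]
        simp only [Finset.sum_const, Finset.card_univ, Fintype.card_fin, nsmul_eq_mul]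
        ring
    _ ≤ 4 * (N : ℝ) ^ (1 - d) := by
        have : 0 ≤ (N : ℝ) ^ (1 - d) := by positivity
        linarith

end Deviation

end DeformedGUE

open DeformedGUE in
theorem theorem1p1 (N : ℕ) (hN : 1 ≤ N)
    (Γ : Matrix (Fin N) (Fin N) ℝ) (hΓsymm : Γ.IsSymm) (hΓnonneg : ∀ i j, 0 ≤ Γ i j)
    (Y : Matrix (Fin N) (Fin N) ℂ) (hY : Y.IsHermitian) :
    ∃ G : Matrix (Fin N) (Fin N) ℂ → Matrix (Fin N) (Fin N) ℂ,
      IsDeterministicEquivalent Γ Y G ∧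
      (∀ G', IsDeterministicEquivalent Γ Y G' → Set.EqOn G' G (diagPlus N)) ∧
      (Γ ≠ 0 →
        ∀ (Ω : Type*) [MeasurableSpace Ω] (P : Measure Ω) [IsProbabilityMeasure P]
          (x : Fin N → Fin N → Ω → ℂ), IsStandardGUE x P →
        ∀ δ : ℝ, 0 < δ → δ < 1 → ∀ Λ ∈ diagPlus N, ∀ d : ℝ, 1 < d →
          (ImGE Λ (gammaMax Γ * (2 / (N * (1 - δ))) ^ (1 / 5 : ℝ)) →
            P.real {ω | epsGeneral N (gammaMax Γ) (invImNorm Λ) δ d ≤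
                ‖opStieltjes (profileMatrix Γ x ω + Y) Λ - G Λ‖}
              ≤ 4 * (N : ℝ) ^ (1 - d)) ∧
          (Y.IsDiag →
            ImGE Λ (gammaMax Γ * (N : ℝ) ^ (-(1 / 4) : ℝ) * (1 - δ) ^ (-(1 / 6) : ℝ)) →
            P.real {ω | epsDiagonal N (gammaMax Γ) (invImNorm Λ) δ d ≤
                ‖opStieltjes (profileMatrix Γ x ω + Y) Λ - G Λ‖}
              ≤ 4 * (N : ℝ) ^ (1 - d))) := by
  refine ⟨detEquiv Γ Y, isDeterministicEquivalent_detEquiv hΓnonneg hY,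
    fun G' hG' => hG'.eq_detEquiv hΓnonneg hY, ?_⟩
  intro hΓ0 Ω _ P _ x hx δ hδ hδ1 Λ hΛ d hd
  obtain ⟨hm0, hmle, -⟩ := exists_invImNorm_eq hN hΛ
  have hg0 : 0 < gammaMax Γ := gammaMax_pos hΓnonneg hΓ0
  have hNpos : (0 : ℝ) < N := by exact_mod_cast hN
  have hδ' : 0 < 1 - δ := sub_pos.mpr hδ1
  have hη : 0 < (invImNorm Λ)⁻¹ := inv_pos.mpr hm0
  have hprof : HasProfile (profileCoef Γ) (varianceMatrix Γ) :=
    hasProfile_profileCoef hΓsymm hΓnonneg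
  have hS := varianceMatrix_nonneg hΓnonneg
  have hσ0 : 0 ≤ gammaMax Γ ^ 2 / N := by positivity
  have hSσ : ∀ i j, varianceMatrix Γ i j ≤ gammaMax Γ ^ 2 / N := fun i j =>
    div_le_div_of_nonneg_right (le_gammaMax_sq hΓnonneg i j) hNpos.le
  have hsq : √(gammaMax Γ ^ 2 / N) = gammaMax Γ / √N := by
    rw [Real.sqrt_div (by positivity), Real.sqrt_sq hg0.le]
  have hNsq : √(N : ℝ) * √N = N := Real.mul_self_sqrt hNpos.le
  have hNs : 0 < √(N : ℝ) := Real.sqrt_pos.mpr hNpos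
  -- the gradient of `R(T)` is at most `γ_max ^ 3 * ‖(Im Λ)⁻¹‖ ^ 2 / N`
  have hκ : ∀ i v, gradNorm (wavgResolvent (varianceMatrix Γ) (profileCoef Γ) Y Λ.diag i) v ≤
      gammaMax Γ ^ 3 * invImNorm Λ ^ 2 / N := fun i v => by
    refine (gradNorm_wavgResolvent_le hprof hS hY hη hmle hσ0 hSσ i v).trans (le_of_eq ?_)
    rw [inv_inv, hsq, Fintype.card_fin]
    field_simp
  constructor
  · intro hIm
    have hle := hIm.le_inv_invImNorm hN hΛ
    refine measureReal_deviation_le hN hΓsymm hΓnonneg hΓ0 hY hx hδ hΛ (zero_le_one.trans hd.le)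
      (τ := 2 * gammaMax Γ ^ 3 * invImNorm Λ ^ 4 / N) (fun i => ?_) ?_
    · refine (norm_meanResolvent_diag_sub_le hprof hS hY hη hmle (by positivity) hκ i).trans ?_
      rw [inv_inv]
      have : 0 ≤ gammaMax Γ ^ 3 * invImNorm Λ ^ 4 / N := by positivity
      calc _ = gammaMax Γ ^ 3 * invImNorm Λ ^ 4 / N := by ring
        _ ≤ gammaMax Γ ^ 3 * invImNorm Λ ^ 4 / N + gammaMax Γ ^ 3 * invImNorm Λ ^ 4 / N :=
          le_add_of_nonneg_left this
        _ = _ := by ring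
    · have h5 := pow_le_pow_left₀ (by positivity) hle 5
      have hr : ((2 / (N * (1 - δ)) : ℝ) ^ (1 / 5 : ℝ)) ^ 5 = 2 / (N * (1 - δ)) := by
        rw [← Real.rpow_natCast, ← Real.rpow_mul (by positivity)]
        norm_num
      rw [mul_pow, hr] at h5
      have h6 : gammaMax Γ ^ 2 * (2 * gammaMax Γ ^ 3 * invImNorm Λ ^ 4 / N) =
          (gammaMax Γ ^ 5 * (2 / (N * (1 - δ)))) * ((1 - δ) * invImNorm Λ ^ 4) := by
        field_simp
      rw [h6]
      refine (mul_le_mul_of_nonneg_right h5 (by positivity)).trans (le_of_eq ?_)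
      field_simp
  · intro hYd hIm
    have hle := hIm.le_inv_invImNorm hN hΛ
    have hN32 : (N : ℝ) ^ (3 / 2 : ℝ) = N * √N := by
      rw [show (3 / 2 : ℝ) = 1 + 1 / 2 by norm_num, Real.rpow_add hNpos, Real.rpow_one,
        Real.sqrt_eq_rpow]
    refine measureReal_deviation_le hN hΓsymm hΓnonneg hΓ0 hY hx hδ hΛ (zero_le_one.trans hd.le)
      (τ := gammaMax Γ ^ 4 * invImNorm Λ ^ 5 / (N : ℝ) ^ (3 / 2 : ℝ)) (fun i => ?_) ?_
    · refine (norm_meanResolvent_diag_sub_le_of_isDiag hprof hS hY hYd hη hmle hσ0 hSσ hκ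
        i).trans (le_of_eq ?_)
      rw [inv_inv, hsq, hN32]
      field_simp
    · have h6 := pow_le_pow_left₀ (by positivity) hle 6
      have hr1 : ((N : ℝ) ^ (-(1 / 4) : ℝ)) ^ 6 = ((N : ℝ) ^ (3 / 2 : ℝ))⁻¹ := by
        rw [← Real.rpow_natCast, ← Real.rpow_mul hNpos.le, ← Real.rpow_neg hNpos.le]
        norm_num
      have hr2 : ((1 - δ) ^ (-(1 / 6) : ℝ)) ^ 6 = (1 - δ)⁻¹ := by
        rw [← Real.rpow_natCast, ← Real.rpow_mul hδ'.le, ← Real.rpow_neg_one]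
        norm_num
      rw [mul_pow, mul_pow, hr1, hr2] at h6
      have hNp : 0 < (N : ℝ) ^ (3 / 2 : ℝ) := Real.rpow_pos_of_pos hNpos _
      have h7 : gammaMax Γ ^ 2 * (gammaMax Γ ^ 4 * invImNorm Λ ^ 5 / (N : ℝ) ^ (3 / 2 : ℝ)) =
          (gammaMax Γ ^ 6 * ((N : ℝ) ^ (3 / 2 : ℝ))⁻¹ * (1 - δ)⁻¹) *
            ((1 - δ) * invImNorm Λ ^ 5) := by
        field_simp
      rw [h7]
      refine (mul_le_mul_of_nonneg_right h6 (by positivity)).trans (le_of_eq ?_)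
      field_simp
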